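/- Logarithms are binary; all Hilbert spaces are finite-dimensional. A state is a positive semidefinite operator of trace $1$; $\|M\|_1=\operatorname{tr}\sqrt{M^\dagger M}$; $\rho^E=\operatorname{tr}_A\rho^{AE}$. The conditional min-entropy of a state $\rho^{AE}$ is $H_\infty(A|E)_\rho=-\log\min\{\lambda:\ \rho^{AE}\le\lambda\,\mathbb I^A\otimes\sigma^E\text{ for some state }\sigma^E\}$. An encryption scheme is a finite family $\{\mathcal E_k\}_{k\in K}$ of quantum channels $A\to A'$, indexed by a uniform key, such that for every $k$ some channel $\mathcal D_k$ satisfies $(\mathcal D_k\otimes\mathrm{id})(\mathcal E_k\otimes\mathrm{id})(\rho^{AE})=\rho^{AE}$ for all states; write $\mathcal E(\rho^{AE})=\frac1{|K|}\sum_{k}(\mathcal E_k\otimes\mathrm{id}_E)(\rho^{AE})$. The scheme is - $(t,\varepsilon)$-indistinguishable if there is a state $\Omega^{A'}$ such that $\|\mathcal E(\rho^{AE})-\Omega^{A'}\otimes\rho^E\|_1<\varepsilon$ for all $E$ and all states $\rho^{AE}$ with $H_\infty(A|E)_\rho\ge t$; - $(t,\varepsilon)$-entropically secure if for all $E$, all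 states $\rho^{AE}$ with $H_\infty(A|E)_\rho\ge t$, all finite decompositions $\rho^{AE}=\sum_ip_i\sigma_i^{AE}$ into states with probabilities $p_i$, all POVMs $\mathsf A$ on $A'E$ and all functions $f$ of $i$, there is a POVM $\mathsf A'$ on $E$ with $\bigl|\Pr[\mathsf A(\mathcal E(\sigma_i^{AE}))=f(i)]-\Pr[\mathsf A'(\sigma_i^E)=f(i)]\bigr|\le\varepsilon$, where $i$ is drawn with probability $p_i$. A finite nonempty family $(s_k)_{k\in K}$ of $N$-bit strings (for example a set of strings, indexed by itself) is $\delta$-biased if $\bigl|\frac1{|K|}\sum_k(-1)^{s_k\odot s'}\bigr|\le\delta$ for every nonzero $s'\in\{0,1\}^N$, where $\odot$ is the inner product modulo $2$. Let $d_A=2^n$. The Ambainis–Smith scheme of a family of $2n$-bit strings encrypts the $n$-qubit system $A$ under the key $k$ by $M\mapsto X^aZ^bMZ^bX^a$, where $s_k=a\|b$, $|a|=|b|=n$, $X^a=X^{a_1}\otimes\dots\otimes X^{a_n}$, $Z^b=Z^{b_1}\otimes\dots\otimes Z^{b_n}$. Put $\kappa=\kappa(n,t,\varepsilon)=n-t+2\log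 n+2\log(1/\varepsilon)+2$. **Theorem.** 1. Let $\delta\ge0$ and let $(s_k)$ be a $\delta$-biased family of $2n$-bit strings. Its Ambainis–Smith scheme is an encryption scheme, and for every real $t$ and every state $\rho^{AE}$ with $H_\infty(A|E)_\rho\ge t$, $$\Bigl\|\mathcal E(\rho^{AE})-\frac{\mathbb I}{d_A}\otimes\rho^E\Bigr\|_1\le\delta\sqrt{d_A2^{-t}}.$$ 2. Let $n\ge1$, $t\in\mathbb R$, $\varepsilon>0$, and fix $m$ and an $\mathbb F_2$-basis of $GF(2^m)$, which identifies $GF(2^m)$ with $\{0,1\}^m$. The Alon–Goldreich–Håstad–Peralta (AGHP) powering construction, which maps a $2m$-bit key $(x,y)$ to the $2n$-bit string with bits $x^i\odot y$, $0\le i<2n$, is $\frac{2n}{2^m}$-biased. If $2m\ge\kappa$, then it is $\varepsilon2^{-(n-t)/2}$-biased, and its Ambainis–Smith scheme, which uses $2m$ bits of key, is both $(t,\varepsilon)$-indistinguishable and $(t,\varepsilon)$-entropically secure. In particular, if $\kappa$ is a positive even integer, $\kappa$ bits of key suffice. 3. For arbitrary $n\ge1$, $t\in\mathbb R$ and $\varepsilon>0$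 with $\kappa\ge0$, there is an $\varepsilon2^{-(n-t)/2}$-biased set $S\subseteq\{0,1\}^{2n}$ of size $2^r$, with $r$ an integer and $r\le\kappa$, whose Ambainis–Smith scheme (which uses $r$ bits of key) is both $(t,\varepsilon)$-indistinguishable and $(t,\varepsilon)$-entropically secure. -/

import Mathlib

open Matrix
open scoped Kronecker MatrixOrder ComplexOrder

noncomputable section

namespace EntropicCipher

/-! ### States, partial trace, trace norm, conditional min-entropy -/

/-- A quantum state on the finite-dimensional Hilbert space `ℂ^A`: a positive semidefinite
operator of trace one. -/
def IsState {A : Type} [Fintype A] (ρ : Matrix A A ℂ) : Prop :=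
  ρ.PosSemidef ∧ ρ.trace = 1

/-- The reduced operator `ρ^E = tr_A ρ^{AE}`. -/
def trA {A E : Type} [Fintype A] (ρ : Matrix (A × E) (A × E) ℂ) : Matrix E E ℂ :=
  Matrix.of fun e e' => ∑ a, ρ (a, e) (a, e')

/-- The trace norm `‖M‖₁ = tr |M|`, with `|M| = √(M† M)`. -/
def traceNorm {A : Type} [Fintype A] [DecidableEq A] (M : Matrix A A ℂ) : ℝ :=
  (CFC.sqrt (Mᴴ * M)).trace.re

/-- The conditional min-entropy `H_∞(A|E)_ρ`: minus the binary logarithm of the least `λ` such that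
`ρ^{AE} ≤ λ 𝕀^A ⊗ σ^E` for some state `σ^E`. -/
def condMinEntropy {A E : Type} [Fintype A] [DecidableEq A] [Fintype E]
    (ρ : Matrix (A × E) (A × E) ℂ) : ℝ :=
  -Real.logb 2 (sInf {l : ℝ | ∃ σ : Matrix E E ℂ, IsState σ ∧
    ((l : ℂ) • ((1 : Matrix A A ℂ) ⊗ₖ σ) - ρ).PosSemidef})

/-! ### Superoperators and encryption schemes -/

/-- The action `Φ ⊗ id_E` of a superoperator `Φ` on the first factor of a bipartite operator:
`Φ` is applied to every `A`-block of `ρ`. -/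
def ampliation {A B E : Type} (Φ : Matrix A A ℂ →ₗ[ℂ] Matrix B B ℂ)
    (ρ : Matrix (A × E) (A × E) ℂ) : Matrix (B × E) (B × E) ℂ :=
  Matrix.of fun x y => Φ (Matrix.of fun a a' => ρ (a, x.2) (a', y.2)) x.1 y.1

/-- Completely positive trace-preserving maps. -/
def IsChannel {A B : Type} [Fintype A] [Fintype B]
    (Φ : Matrix A A ℂ →ₗ[ℂ] Matrix B B ℂ) : Prop :=
  (∀ M : Matrix A A ℂ, (Φ M).trace = M.trace) ∧
  ∀ (E : Type) [Fintype E] (ρ : Matrix (A × E) (A × E) ℂ),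
    ρ.PosSemidef → (ampliation Φ ρ).PosSemidef

/-- An encryption scheme: a family of superoperators indexed by the key, each of which is a
quantum channel with an inverting channel. -/
def IsEncryptionScheme {K A B : Type} [Fintype A] [Fintype B]
    (enc : K → Matrix A A ℂ →ₗ[ℂ] Matrix B B ℂ) : Prop :=
  ∀ k, IsChannel (enc k) ∧
    ∃ D : Matrix B B ℂ →ₗ[ℂ] Matrix A A ℂ, IsChannel D ∧
      ∀ (E : Type) [Fintype E] (ρ : Matrix (A × E) (A × E) ℂ), IsState ρ →
        ampliation D (ampliation (enc k) ρ) = ρ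

/-- The adversary's view `ℰ(ρ^{AE}) = |K|⁻¹ ∑_k (ℰ_k ⊗ id_E)(ρ^{AE})` for a uniform key. -/
def view {K A B E : Type} [Fintype K]
    (enc : K → Matrix A A ℂ →ₗ[ℂ] Matrix B B ℂ)
    (ρ : Matrix (A × E) (A × E) ℂ) : Matrix (B × E) (B × E) ℂ :=
  ((Fintype.card K : ℂ))⁻¹ • ∑ k, ampliation (enc k) ρ

/-- `(t, ε)`-entropic indistinguishability. -/
def IsIndistinguishable {K A B : Type} [Fintype K] [Fintype A] [DecidableEq A]
    [Fintype B] [DecidableEq B]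
    (enc : K → Matrix A A ℂ →ₗ[ℂ] Matrix B B ℂ) (t ε : ℝ) : Prop :=
  ∃ Ω : Matrix B B ℂ, IsState Ω ∧
    ∀ (E : Type) [Fintype E] [DecidableEq E] (ρ : Matrix (A × E) (A × E) ℂ),
      IsState ρ → t ≤ condMinEntropy ρ →
        traceNorm (view enc ρ - Ω ⊗ₖ trA ρ) < ε

/-- A POVM on `ℂ^A` with outcomes in `Y`. -/
def IsPOVM {A Y : Type} [Fintype A] [DecidableEq A] [Fintype Y] (P : Y → Matrix A A ℂ) : Prop :=
  (∀ y, (P y).PosSemidef) ∧ ∑ y, P y = 1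

/-- `(t, ε)`-entropic security. The adversary's output, with law `y ↦ tr[P_y γ]` on the state `γ`,
is its prediction of `f i`, where `i` has law `p`; `{(p_i, σ_i)}` is an interpretation of `ρ`. -/
def IsEntropicallySecure {K A B : Type} [Fintype K] [Fintype A] [DecidableEq A]
    [Fintype B] [DecidableEq B]
    (enc : K → Matrix A A ℂ →ₗ[ℂ] Matrix B B ℂ) (t ε : ℝ) : Prop :=
  ∀ (E : Type) [Fintype E] [DecidableEq E] (ρ : Matrix (A × E) (A × E) ℂ),
    IsState ρ → t ≤ condMinEntropy ρ →
    ∀ (I : Type) [Fintype I] (p : I → ℝ) (σ : I → Matrix (A × E) (A × E) ℂ),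
      (∀ i, 0 ≤ p i) → ∑ i, p i = 1 → (∀ i, IsState (σ i)) →
      ∑ i, (p i : ℂ) • σ i = ρ →
      ∀ (Y : Type) [Fintype Y] (P : Y → Matrix (B × E) (B × E) ℂ), IsPOVM P →
        ∀ f : I → Y, ∃ P' : Y → Matrix E E ℂ, IsPOVM P' ∧
          |∑ i, p i * (P (f i) * view enc (σ i)).trace.re
            - ∑ i, p i * (P' (f i) * trA (σ i)).trace.re| ≤ ε

/-! ### Pauli operators and the Ambainis–Smith scheme -/

/-- The Pauli matrix `X`. -/
def pauliX : Matrix (Fin 2) (Fin 2) ℂ := !![0, 1; 1, 0]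

/-- The Pauli matrix `Z`. -/
def pauliZ : Matrix (Fin 2) (Fin 2) ℂ := !![1, 0; 0, -1]

/-- `P^a = P^{a_1} ⊗ ⋯ ⊗ P^{a_n}`, an operator on `n` qubits, in the computational basis. -/
def tensorPow {n : ℕ} (P : Matrix (Fin 2) (Fin 2) ℂ) (a : Fin n → ZMod 2) :
    Matrix (Fin n → Fin 2) (Fin n → Fin 2) ℂ :=
  Matrix.of fun x y => ∏ i, (P ^ (a i).val) (x i) (y i)

/-- A finite nonempty family of `N`-bit strings is `δ`-biased if
`| |K|⁻¹ ∑_k (-1)^{s_k ⊙ s'} | ≤ δ` for every `s' ≠ 0`. A set `S` of strings is the family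
`Subtype.val : S → _`; a family with repetitions is a multiset of strings. -/
def IsDeltaBiased {K : Type} [Fintype K] {N : ℕ} (δ : ℝ) (s : K → Fin N → ZMod 2) : Prop :=
  Nonempty K ∧ ∀ s' : Fin N → ZMod 2, s' ≠ 0 →
    |(Fintype.card K : ℝ)⁻¹ * ∑ k, (-1 : ℝ) ^ (s k ⬝ᵥ s').val| ≤ δ

/-- The Ambainis–Smith scheme of a family of `2n`-bit strings: for the key `k` with
`s_k = a‖b`, apply `M ↦ X^a Z^b M Z^b X^a`. -/
def ambainisSmith {K : Type} {n : ℕ} (s : K → Fin (n + n) → ZMod 2) (k : K) :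
    Matrix (Fin n → Fin 2) (Fin n → Fin 2) ℂ →ₗ[ℂ] Matrix (Fin n → Fin 2) (Fin n → Fin 2) ℂ :=
  let a : Fin n → ZMod 2 := fun i => s k (Fin.castAdd n i)
  let b : Fin n → ZMod 2 := fun i => s k (Fin.natAdd n i)
  LinearMap.mulLeft ℂ (tensorPow pauliX a * tensorPow pauliZ b) ∘ₗ
    LinearMap.mulRight ℂ (tensorPow pauliZ b * tensorPow pauliX a)

/-- The powering construction of Alon, Goldreich, Håstad and Peralta: the seed is a pair `(x, y)`
of `m`-bit strings, `x` is read as an element of `GF(2^m)` through the basis `β`, and the `i`-th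
output bit (`i = 0, …, N - 1`) is the inner product of the bit string of `x^i` with `y`. -/
def aghp {m : ℕ} (β : Module.Basis (Fin m) (ZMod 2) (GaloisField 2 m)) (N : ℕ)
    (k : (Fin m → ZMod 2) × (Fin m → ZMod 2)) (i : Fin N) : ZMod 2 :=
  β.equivFun (β.equivFun.symm k.1 ^ (i : ℕ)) ⬝ᵥ k.2

/-- The number of key bits `n - t + 2 log n + 2 log(1/ε) + 2`. -/
def keyLength (n : ℕ) (t ε : ℝ) : ℝ :=
  n - t + 2 * Real.logb 2 n + 2 * Real.logb 2 (1 / ε) + 2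

end EntropicCipher

end

/-! Conjugation by `X^a Z^b` preserves the sum `x + y` of the two matrix indices. The averaged
cipher therefore acts on each diagonal `x ↦ M x (x + z)` separately, by shifts and signs. The Walsh
transform diagonalizes this action, and the multiplier at `w` is the bias of the family at the
string `w‖z`. Subtracting the completely depolarizing channel removes exactly the trivial character,
so by Parseval the remainder `deviation` contracts the Hilbert–Schmidt norm by `δ`
(`hsSq_deviation_le`), also in the presence of `E`.

Min-entropy turns this into an operational bound. If `ρ ≤ μ 𝕀 ⊗ σ` with `σ` faithful, the weights
`σ^{1/4}` and `σ^{-1/4}` on `E` pass through `deviation`, and Cauchy–Schwarz bounds the pairing of a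
suitable observable with the deviation by `δ √(d_A μ)` (`sq_sum_re_trace_mul_ampliation_le`). This
is proved for a family of observables paired with a family of operators of total trace one. A single
sign unitary then gives the trace norm, and a POVM paired with the pieces of `ρ` grouped by the
value of `f` gives entropic security, with the same constant whatever the number of outcomes.

The key length `κ` satisfies `δ² 2^κ = 4n²` at `δ = ε 2^{-(n-t)/2}`. For the powering construction
the bias is the proportion of zeros of a polynomial of degree less than `2n`. For small-bias sets, a
random set of `M` strings has exponential moments no larger than `M` independent strings, and a
Chernoff and union bound shows that `M ≥ 2n²/δ²` suffices (`exists_finset_bias_lt`); the spare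
factor 2 pays for rounding `κ` down. Indistinguishability is a strict inequality, so both
constructions are shown to have bias strictly below the target. -/

noncomputable section

namespace EntropicCipher

/-! ### Sign characters of `(ZMod 2)^n` -/

/-- The sign `(-1)^a` of a bit. -/
def sgn (R : Type*) [Ring R] (a : ZMod 2) : R := (-1) ^ a.val

section sgn

variable {R : Type*} [Ring R]

lemma sgn_zero : sgn R 0 = 1 := by simp [sgn]

lemma sgn_one : sgn R 1 = -1 := by
  simp [sgn, show (1 : ZMod 2).val = 1 from rfl]

lemma zmod_two_cases (a : ZMod 2) : a = 0 ∨ a = 1 := by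
  revert a; decide

lemma sgn_add (a b : ZMod 2) : sgn R (a + b) = sgn R a * sgn R b := by
  rcases zmod_two_cases a with rfl | rfl <;> rcases zmod_two_cases b with rfl | rfl
  · simp [sgn_zero]
  · simp [sgn_zero]
  · simp [sgn_zero]
  · rw [show (1 : ZMod 2) + 1 = 0 from rfl]
    simp [sgn_zero, sgn_one]

lemma sgn_sum {R ι : Type*} [CommRing R] (s : Finset ι) (f : ι → ZMod 2) :
    sgn R (∑ i ∈ s, f i) = ∏ i ∈ s, sgn R (f i) := by
  classical
  induction s using Finset.induction_on with
  | empty => simp [sgn_zero]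
  | insert a s ha ih => rw [Finset.sum_insert ha, Finset.prod_insert ha, sgn_add, ih]

lemma ofReal_sgn (a : ZMod 2) : ((sgn ℝ a : ℝ) : ℂ) = sgn ℂ a := by
  simp [sgn]

lemma star_sgn (a : ZMod 2) : star (sgn ℂ a) = sgn ℂ a := by
  simp [sgn]

lemma abs_sgn (a : ZMod 2) : |sgn ℝ a| = 1 := by
  simp [sgn]

/-- Orthogonality of the sign characters. -/
lemma sum_sgn_dotProduct [CharZero R] [NoZeroDivisors R] {N : ℕ} (w : Fin N → ZMod 2)
    (hw : w ≠ 0) : ∑ v : Fin N → ZMod 2, sgn R (v ⬝ᵥ w) = 0 := by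
  obtain ⟨i, hi⟩ := Function.ne_iff.mp hw
  have hi : w i = 1 := (zmod_two_cases _).resolve_left hi
  have h := Equiv.sum_comp (Equiv.addRight (Pi.single i 1 : Fin N → ZMod 2))
    fun v => sgn R (v ⬝ᵥ w)
  simp only [Equiv.coe_addRight, add_dotProduct, single_dotProduct, hi, sgn_add, mul_one, sgn_one,
    mul_neg, Finset.sum_neg_distrib] at h
  exact self_eq_neg.mp h.symm

lemma sum_sgn_dotProduct_eq_ite [CharZero R] [NoZeroDivisors R] {N : ℕ} (w : Fin N → ZMod 2) :
    ∑ v : Fin N → ZMod 2, sgn R (v ⬝ᵥ w) = if w = 0 then 2 ^ N else 0 := by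
  split_ifs with h
  · simp [h, sgn_zero]
  · exact sum_sgn_dotProduct w h

end sgn

lemma bits_add_self {N : ℕ} (a : Fin N → ZMod 2) : a + a = 0 := by
  funext i; exact CharTwo.add_self_eq_zero _

lemma bits_add_eq_zero_iff {N : ℕ} (a b : Fin N → ZMod 2) : a + b = 0 ↔ a = b := by
  constructor
  · intro h
    have := congrArg (· + b) h
    simpa [add_assoc, bits_add_self] using this
  · rintro rfl; exact bits_add_self _

/-- The Walsh–Hadamard transform. -/
def walsh {n : ℕ} (G : (Fin n → ZMod 2) → ℂ) (w : Fin n → ZMod 2) : ℂ :=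
  ∑ x, sgn ℂ (w ⬝ᵥ x) * G x

/-- Parseval's identity for the Walsh–Hadamard transform. -/
lemma sum_norm_walsh_sq {n : ℕ} (G : (Fin n → ZMod 2) → ℂ) :
    ∑ w, ‖walsh G w‖ ^ 2 = 2 ^ n * ∑ x, ‖G x‖ ^ 2 := by
  have key : ∀ w, ((‖walsh G w‖ ^ 2 : ℝ) : ℂ) =
      ∑ x, ∑ y, sgn ℂ (w ⬝ᵥ (x + y)) * (G x * star (G y)) := by
    intro w
    have : ((‖walsh G w‖ ^ 2 : ℝ) : ℂ) = walsh G w * star (walsh G w) := by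
      rw [Complex.star_def, Complex.mul_conj, Complex.normSq_eq_norm_sq]
    rw [this, walsh, star_sum, Finset.sum_mul_sum]
    refine Finset.sum_congr rfl fun x _ => Finset.sum_congr rfl fun y _ => ?_
    rw [star_mul', star_sgn, dotProduct_add, sgn_add]
    ring
  have : ((∑ w, ‖walsh G w‖ ^ 2 : ℝ) : ℂ) = ((2 ^ n * ∑ x, ‖G x‖ ^ 2 : ℝ) : ℂ) := by
    rw [Complex.ofReal_sum, Finset.sum_congr rfl fun w _ => key w, Finset.sum_comm]
    simp_rw [Finset.sum_comm (s := Finset.univ (α := Fin n → ZMod 2)) (t := Finset.univ)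
      (f := fun w y => sgn ℂ (w ⬝ᵥ (_ + y)) * _)]
    simp_rw [← Finset.sum_mul, sum_sgn_dotProduct_eq_ite, bits_add_eq_zero_iff, ite_mul, zero_mul]
    simp only [Finset.sum_ite_eq, Finset.mem_univ, if_true, ← Finset.mul_sum]
    push_cast
    congr 1
    refine Finset.sum_congr rfl fun x _ => ?_
    rw [Complex.star_def, Complex.mul_conj, Complex.normSq_eq_norm_sq]
    push_cast; rfl
  exact_mod_cast this

/-- The bias of a family of strings at the character `s'`. -/
def bias {K : Type} [Fintype K] {N : ℕ} (s : K → Fin N → ZMod 2) (s' : Fin N → ZMod 2) : ℝ :=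
  (Fintype.card K : ℝ)⁻¹ * ∑ k, sgn ℝ (s k ⬝ᵥ s')

lemma isDeltaBiased_iff {K : Type} [Fintype K] {N : ℕ} {δ : ℝ} {s : K → Fin N → ZMod 2} :
    IsDeltaBiased δ s ↔ Nonempty K ∧ ∀ s', s' ≠ 0 → |bias s s'| ≤ δ := Iff.rfl

/-- The shift part of a `2n`-bit string. -/
def xPart {n : ℕ} (s : Fin (n + n) → ZMod 2) : Fin n → ZMod 2 := fun i => s (Fin.castAdd n i)

/-- The phase part of a `2n`-bit string. -/
def zPart {n : ℕ} (s : Fin (n + n) → ZMod 2) : Fin n → ZMod 2 := fun i => s (Fin.natAdd n i)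

lemma dotProduct_append {n : ℕ} (s : Fin (n + n) → ZMod 2) (w z : Fin n → ZMod 2) :
    s ⬝ᵥ Fin.append w z = xPart s ⬝ᵥ w + zPart s ⬝ᵥ z := by
  simp only [dotProduct, Fin.sum_univ_add, xPart, zPart, Fin.append_left, Fin.append_right]

lemma append_eq_zero_iff {n : ℕ} (w z : Fin n → ZMod 2) :
    Fin.append w z = 0 ↔ w = 0 ∧ z = 0 := by
  constructor
  · intro h
    constructor
    · funext i
      simpa using congrFun h (Fin.castAdd n i)
    · funext i
      simpa only [Fin.append_right, Pi.zero_apply] using congrFun h (Fin.natAdd n i)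
  · rintro ⟨rfl, rfl⟩
    funext i
    refine Fin.addCases (fun i => ?_) (fun i => ?_) i
    · simp only [Fin.append_left, Pi.zero_apply]
    · simp only [Fin.append_right, Pi.zero_apply]

/-- The averaged phase-and-shift operator on the `z`-th diagonal of a matrix, minus its action on
the identity component. -/
def diagDeviation {K : Type} [Fintype K] {n : ℕ} (s : K → Fin (n + n) → ZMod 2)
    (z : Fin n → ZMod 2) (G : (Fin n → ZMod 2) → ℂ) (x : Fin n → ZMod 2) : ℂ :=
  (Fintype.card K : ℂ)⁻¹ * ∑ k, sgn ℂ (zPart (s k) ⬝ᵥ z) * G (x + xPart (s k))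
    - if z = 0 then ((2 : ℂ) ^ n)⁻¹ * ∑ y, G y else 0

/-- A shift by `a` becomes the sign `(-1)^{a ⊙ w}` under the Walsh transform; combined with the
phase on the `z`-th diagonal it is the character of the key string at `w‖z`, and averaging over keys
produces the bias. The subtracted constant has only the coefficient `w = 0`, present only for `z =
0`, where the bias is 1, so it cancels that term exactly. -/
lemma walsh_diagDeviation {K : Type} [Fintype K] [Nonempty K] {n : ℕ}
    (s : K → Fin (n + n) → ZMod 2) (z : Fin n → ZMod 2) (G : (Fin n → ZMod 2) → ℂ)
    (w : Fin n → ZMod 2) :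
    walsh (diagDeviation s z G) w =
      if Fin.append w z = 0 then 0 else (bias s (Fin.append w z) : ℂ) * walsh G w := by
  have hshift : ∀ a : Fin n → ZMod 2,
      ∑ x, sgn ℂ (w ⬝ᵥ x) * G (x + a) = sgn ℂ (a ⬝ᵥ w) * walsh G w := by
    intro a
    rw [← Equiv.sum_comp (Equiv.addRight a), walsh, Finset.mul_sum]
    refine Finset.sum_congr rfl fun x _ => ?_
    rw [Equiv.coe_addRight, add_assoc, bits_add_self, add_zero, dotProduct_add, sgn_add,
      dotProduct_comm w a]
    ring
  have h1 : walsh (fun x => (Fintype.card K : ℂ)⁻¹ *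
      ∑ k, sgn ℂ (zPart (s k) ⬝ᵥ z) * G (x + xPart (s k))) w
        = (bias s (Fin.append w z) : ℂ) * walsh G w := by
    have : ∀ x, sgn ℂ (w ⬝ᵥ x) * ((Fintype.card K : ℂ)⁻¹ *
        ∑ k, sgn ℂ (zPart (s k) ⬝ᵥ z) * G (x + xPart (s k))) =
        (Fintype.card K : ℂ)⁻¹ * ∑ k, sgn ℂ (zPart (s k) ⬝ᵥ z) *
          (sgn ℂ (w ⬝ᵥ x) * G (x + xPart (s k))) := by
      intro x
      rw [mul_left_comm, Finset.mul_sum]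
      congr 1
      exact Finset.sum_congr rfl fun k _ => by ring
    rw [walsh, Finset.sum_congr rfl fun x _ => this x, ← Finset.mul_sum, Finset.sum_comm]
    simp_rw [← Finset.mul_sum, hshift, bias]
    push_cast
    simp_rw [ofReal_sgn, dotProduct_append, sgn_add]
    rw [mul_assoc, Finset.sum_mul]
    congr 1
    exact Finset.sum_congr rfl fun k _ => by ring
  have h2 : walsh (diagDeviation s z G) w = (bias s (Fin.append w z) : ℂ) * walsh G w
      - ∑ x, sgn ℂ (w ⬝ᵥ x) * if z = 0 then ((2 : ℂ) ^ n)⁻¹ * ∑ y, G y else 0 := by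
    rw [← h1, walsh, walsh, ← Finset.sum_sub_distrib]
    exact Finset.sum_congr rfl fun x _ => by rw [diagDeviation, mul_sub]
  rw [h2, ← Finset.sum_mul]
  simp_rw [dotProduct_comm w, sum_sgn_dotProduct_eq_ite]
  by_cases hw : w = 0
  · by_cases hz : z = 0
    · rw [if_pos ((append_eq_zero_iff w z).2 ⟨hw, hz⟩), (append_eq_zero_iff w z).2 ⟨hw, hz⟩]
      simp [hw, hz, bias, walsh, sgn_zero]
    · rw [if_neg fun h => hz ((append_eq_zero_iff w z).1 h).2]
      simp [hz]
  · rw [if_neg fun h => hw ((append_eq_zero_iff w z).1 h).1]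
    simp [hw]

/-- By Parseval it suffices to compare Walsh coefficients, and each surviving one is multiplied by a
bias at a nonzero string. -/
lemma sum_norm_diagDeviation_sq_le {K : Type} [Fintype K] {n : ℕ}
    {s : K → Fin (n + n) → ZMod 2} {δ : ℝ} (hs : IsDeltaBiased δ s)
    (z : Fin n → ZMod 2) (G : (Fin n → ZMod 2) → ℂ) :
    ∑ x, ‖diagDeviation s z G x‖ ^ 2 ≤ δ ^ 2 * ∑ x, ‖G x‖ ^ 2 := by
  obtain ⟨hK, hs⟩ := isDeltaBiased_iff.1 hs
  have h : ∑ w, ‖walsh (diagDeviation s z G) w‖ ^ 2 ≤ δ ^ 2 * ∑ w, ‖walsh G w‖ ^ 2 := by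
    rw [Finset.mul_sum]
    refine Finset.sum_le_sum fun w _ => ?_
    rw [walsh_diagDeviation]
    split_ifs with h0
    · simp; positivity
    · rw [norm_mul, mul_pow, Complex.norm_real, Real.norm_eq_abs]
      gcongr
      exact hs _ h0
  rw [sum_norm_walsh_sq, sum_norm_walsh_sq, mul_left_comm] at h
  exact le_of_mul_le_mul_left h (by positivity)

/-! ### Pauli operators -/

/-- `ZMod 2` unfolds to `Fin 2`, so basis labels can be read as bits and added; the computations
with `x + a` below rest on this identification. -/
lemma pauliX_pow_apply (a x y : ZMod 2) :
    (pauliX ^ a.val) (x : Fin 2) (y : Fin 2) = if y = x + a then 1 else 0 := by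
  rcases zmod_two_cases a with rfl | rfl <;> rcases zmod_two_cases x with rfl | rfl <;>
    rcases zmod_two_cases y with rfl | rfl <;>
    first
      | (rw [show (1 : ZMod 2).val = 1 from rfl, pow_one]
         simp [pauliX, show (1 : ZMod 2) + 1 = 0 from rfl])
      | (rw [show (0 : ZMod 2).val = 0 from rfl, pow_zero]
         simp)
  all_goals rfl

lemma pauliZ_pow_apply (b x y : ZMod 2) :
    (pauliZ ^ b.val) (x : Fin 2) (y : Fin 2) = if x = y then sgn ℂ (b * x) else 0 := by
  rcases zmod_two_cases b with rfl | rfl <;> rcases zmod_two_cases x with rfl | rfl <;>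
    rcases zmod_two_cases y with rfl | rfl <;>
    first
      | (rw [show (1 : ZMod 2).val = 1 from rfl, pow_one]
         simp [pauliZ, sgn_zero, sgn_one])
      | (rw [show (0 : ZMod 2).val = 0 from rfl, pow_zero]
         simp [sgn_zero])
  all_goals rfl

lemma prod_ite_eq_ite_forall {n : ℕ} (p : Fin n → Prop) [DecidablePred p] [Decidable (∀ i, p i)]
    (f : Fin n → ℂ) :
    ∏ i, (if p i then f i else 0) = if ∀ i, p i then ∏ i, f i else 0 := by
  split_ifs with h
  · exact Finset.prod_congr rfl fun i _ => if_pos (h i)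
  · push Not at h
    obtain ⟨i, hi⟩ := h
    exact Finset.prod_eq_zero (Finset.mem_univ i) (if_neg hi)

lemma tensorPow_pauliX_apply {n : ℕ} (a x y : Fin n → ZMod 2) :
    tensorPow pauliX a x y = if y = x + a then 1 else 0 := by
  have : tensorPow pauliX a x y = ∏ i, if y i = x i + a i then (1 : ℂ) else 0 := by
    change ∏ i, (pauliX ^ (a i).val) (x i) (y i) = _
    exact Finset.prod_congr rfl fun i _ => pauliX_pow_apply (a i) (x i) (y i)
  rw [this, prod_ite_eq_ite_forall, Finset.prod_const_one]
  simp [funext_iff]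

lemma tensorPow_pauliZ_apply {n : ℕ} (b x y : Fin n → ZMod 2) :
    tensorPow pauliZ b x y = if x = y then sgn ℂ (b ⬝ᵥ x) else 0 := by
  have : tensorPow pauliZ b x y = ∏ i, if x i = y i then sgn ℂ (b i * x i) else 0 := by
    change ∏ i, (pauliZ ^ (b i).val) (x i) (y i) = _
    exact Finset.prod_congr rfl fun i _ => pauliZ_pow_apply (b i) (x i) (y i)
  rw [this, prod_ite_eq_ite_forall, dotProduct, sgn_sum]
  simp [funext_iff]

/-- The unitary `X^a Z^b`, with rows and columns indexed by `(ZMod 2)^n`. -/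
def pauli {n : ℕ} (a b : Fin n → ZMod 2) : Matrix (Fin n → ZMod 2) (Fin n → ZMod 2) ℂ :=
  Matrix.of fun x y => if y = x + a then sgn ℂ (b ⬝ᵥ y) else 0

lemma tensorPow_pauliX_mul_pauliZ {n : ℕ} (a b : Fin n → ZMod 2) :
    tensorPow pauliX a * tensorPow pauliZ b = pauli a b := by
  have h : ∀ x y : Fin n → ZMod 2, ∑ w : Fin n → ZMod 2,
      tensorPow pauliX a x w * tensorPow pauliZ b w y = pauli a b x y := by
    intro x y
    simp only [tensorPow_pauliX_apply, tensorPow_pauliZ_apply, ite_mul, one_mul, zero_mul,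
      Finset.sum_ite_eq', Finset.mem_univ, if_true, pauli, Matrix.of_apply]
    by_cases hxy : y = x + a
    · simp [hxy]
    · simp [hxy, Ne.symm hxy]
  ext x y
  exact h x y

lemma tensorPow_pauliZ_mul_pauliX {n : ℕ} (a b : Fin n → ZMod 2) :
    tensorPow pauliZ b * tensorPow pauliX a = (pauli a b)ᴴ := by
  have h : ∀ x y : Fin n → ZMod 2, ∑ w : Fin n → ZMod 2,
      tensorPow pauliZ b x w * tensorPow pauliX a w y = (pauli a b)ᴴ x y := by
    intro x y
    simp only [tensorPow_pauliX_apply, tensorPow_pauliZ_apply, ite_mul, zero_mul,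
      Finset.sum_ite_eq, Finset.mem_univ, if_true, pauli, conjTranspose_apply, Matrix.of_apply]
    have hiff : y = x + a ↔ x = y + a := by
      constructor <;> rintro rfl <;> rw [add_assoc, bits_add_self, add_zero]
    by_cases hxy : y = x + a
    · rw [if_pos hxy, if_pos (hiff.1 hxy), star_sgn, mul_one]
    · rw [if_neg hxy, if_neg (hiff.not.1 hxy), star_zero, mul_zero]
  ext x y
  exact h x y

lemma pauli_mul_apply {n : ℕ} (a b : Fin n → ZMod 2)
    (M : Matrix (Fin n → ZMod 2) (Fin n → ZMod 2) ℂ) (x y : Fin n → ZMod 2) :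
    (pauli a b * M) x y = sgn ℂ (b ⬝ᵥ (x + a)) * M (x + a) y := by
  simp [Matrix.mul_apply, pauli]

lemma mul_pauli_conjTranspose_apply {n : ℕ} (a b : Fin n → ZMod 2)
    (M : Matrix (Fin n → ZMod 2) (Fin n → ZMod 2) ℂ) (x y : Fin n → ZMod 2) :
    (M * (pauli a b)ᴴ) x y = M x (y + a) * sgn ℂ (b ⬝ᵥ (y + a)) := by
  have h : ∀ w, M x w * star (if w = y + a then sgn ℂ (b ⬝ᵥ w) else 0) =
      if w = y + a then M x w * sgn ℂ (b ⬝ᵥ w) else 0 := by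
    intro w
    split_ifs
    · rw [star_sgn]
    · simp
  simp only [Matrix.mul_apply, pauli, conjTranspose_apply, Matrix.of_apply, h, Finset.sum_ite_eq',
    Finset.mem_univ, if_true]

/-- The sign depends only on `x + y`, which the shift by `a` leaves unchanged; hence every diagonal
is mapped to itself. -/
lemma pauli_conj_apply {n : ℕ} (a b : Fin n → ZMod 2)
    (M : Matrix (Fin n → ZMod 2) (Fin n → ZMod 2) ℂ) (x y : Fin n → ZMod 2) :
    (pauli a b * (M * (pauli a b)ᴴ)) x y = sgn ℂ (b ⬝ᵥ (x + y)) * M (x + a) (y + a) := by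
  have h : x + y = (x + a) + (y + a) := by
    rw [add_add_add_comm, bits_add_self, add_zero]
  rw [pauli_mul_apply, mul_pauli_conjTranspose_apply, h, dotProduct_add b (x + a), sgn_add]
  ring

lemma pauli_mul_conjTranspose {n : ℕ} (a b : Fin n → ZMod 2) :
    pauli a b * (pauli a b)ᴴ = 1 := by
  ext x y
  have h := pauli_conj_apply a b 1 x y
  rw [one_mul] at h
  rw [h, Matrix.one_apply, Matrix.one_apply]
  by_cases hxy : x = y
  · simp [hxy, bits_add_self, sgn_zero]
  · simp [hxy]

lemma pauli_conjTranspose_mul {n : ℕ} (a b : Fin n → ZMod 2) :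
    (pauli a b)ᴴ * pauli a b = 1 :=
  mul_eq_one_comm.1 (pauli_mul_conjTranspose a b)

/-! ### Ampliation -/

lemma ampliation_id {A E : Type} (ρ : Matrix (A × E) (A × E) ℂ) :
    ampliation LinearMap.id ρ = ρ := rfl

lemma ampliation_comp {A B C E : Type} (Ψ : Matrix B B ℂ →ₗ[ℂ] Matrix C C ℂ)
    (Φ : Matrix A A ℂ →ₗ[ℂ] Matrix B B ℂ) (ρ : Matrix (A × E) (A × E) ℂ) :
    ampliation Ψ (ampliation Φ ρ) = ampliation (Ψ ∘ₗ Φ) ρ := rfl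

/-- Ampliation, as a linear map in the operator. -/
def ampliationₗ {A B : Type} (E : Type) (Φ : Matrix A A ℂ →ₗ[ℂ] Matrix B B ℂ) :
    Matrix (A × E) (A × E) ℂ →ₗ[ℂ] Matrix (B × E) (B × E) ℂ where
  toFun := ampliation Φ
  map_add' M N := by
    ext x y
    exact congrFun₂ (Φ.map_add (Matrix.of fun a a' => M (a, x.2) (a', y.2))
      (Matrix.of fun a a' => N (a, x.2) (a', y.2))) x.1 y.1
  map_smul' c M := by
    ext x y
    exact congrFun₂ (Φ.map_smul c (Matrix.of fun a a' => M (a, x.2) (a', y.2))) x.1 y.1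

lemma ampliationₗ_apply {A B E : Type} (Φ : Matrix A A ℂ →ₗ[ℂ] Matrix B B ℂ)
    (M : Matrix (A × E) (A × E) ℂ) : ampliationₗ E Φ M = ampliation Φ M := rfl

lemma one_kronecker_mul_apply {A E : Type} [Fintype A] [DecidableEq A] [Fintype E]
    (r : Matrix E E ℂ) (M : Matrix (A × E) (A × E) ℂ) (x y : A × E) :
    (((1 : Matrix A A ℂ) ⊗ₖ r) * M) x y = ∑ f, r x.2 f * M (x.1, f) y := by
  simp [Matrix.mul_apply, Fintype.sum_prod_type, Matrix.one_apply]

lemma mul_one_kronecker_apply {A E : Type} [Fintype A] [DecidableEq A] [Fintype E]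
    (r : Matrix E E ℂ) (M : Matrix (A × E) (A × E) ℂ) (x y : A × E) :
    (M * ((1 : Matrix A A ℂ) ⊗ₖ r)) x y = ∑ f, M x (y.1, f) * r f y.2 := by
  simp [Matrix.mul_apply, Fintype.sum_prod_type, Matrix.one_apply]

/-- Operators on `E` pass through `Φ ⊗ id`; this is what allows the weights built from `σ^E` to be
moved across the cipher. -/
lemma ampliation_one_kronecker_mul {A B E : Type} [Fintype A] [DecidableEq A] [Fintype B]
    [DecidableEq B] [Fintype E] (Φ : Matrix A A ℂ →ₗ[ℂ] Matrix B B ℂ) (r : Matrix E E ℂ)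
    (M : Matrix (A × E) (A × E) ℂ) :
    ampliation Φ (((1 : Matrix A A ℂ) ⊗ₖ r) * M) = ((1 : Matrix B B ℂ) ⊗ₖ r) * ampliation Φ M := by
  ext x y
  rw [one_kronecker_mul_apply]
  have h : (Matrix.of fun a a' => (((1 : Matrix A A ℂ) ⊗ₖ r) * M) (a, x.2) (a', y.2)) =
      ∑ f, r x.2 f • Matrix.of fun a a' => M (a, f) (a', y.2) := by
    ext a a'
    simp [one_kronecker_mul_apply, Matrix.sum_apply]
  simp only [ampliation, Matrix.of_apply, h, map_sum, map_smul, Matrix.sum_apply,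
    Matrix.smul_apply, smul_eq_mul]

lemma ampliation_mul_one_kronecker {A B E : Type} [Fintype A] [DecidableEq A] [Fintype B]
    [DecidableEq B] [Fintype E] (Φ : Matrix A A ℂ →ₗ[ℂ] Matrix B B ℂ) (r : Matrix E E ℂ)
    (M : Matrix (A × E) (A × E) ℂ) :
    ampliation Φ (M * ((1 : Matrix A A ℂ) ⊗ₖ r)) = ampliation Φ M * ((1 : Matrix B B ℂ) ⊗ₖ r) := by
  ext x y
  rw [mul_one_kronecker_apply]
  have h : (Matrix.of fun a a' => (M * ((1 : Matrix A A ℂ) ⊗ₖ r)) (a, x.2) (a', y.2)) =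
      ∑ f, r f y.2 • Matrix.of fun a a' => M (a, x.2) (a', f) := by
    ext a a'
    simp [mul_one_kronecker_apply, Matrix.sum_apply, mul_comm]
  simp only [ampliation, Matrix.of_apply, h, map_sum, map_smul, Matrix.sum_apply,
    Matrix.smul_apply, smul_eq_mul, mul_comm]

/-- The map `M ↦ U M U†`. -/
def conjBy {A : Type} [Fintype A] (U : Matrix A A ℂ) : Matrix A A ℂ →ₗ[ℂ] Matrix A A ℂ :=
  LinearMap.mulLeft ℂ U ∘ₗ LinearMap.mulRight ℂ Uᴴ

lemma conjBy_apply {A : Type} [Fintype A] (U M : Matrix A A ℂ) :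
    conjBy U M = U * (M * Uᴴ) := rfl

lemma ampliation_conjBy {A E : Type} [Fintype A] [Fintype E] [DecidableEq E]
    (U : Matrix A A ℂ) (ρ : Matrix (A × E) (A × E) ℂ) :
    ampliation (conjBy U) ρ = (U ⊗ₖ (1 : Matrix E E ℂ)) * ρ * (U ⊗ₖ (1 : Matrix E E ℂ))ᴴ := by
  rw [mul_assoc]
  ext x y
  simp [ampliation, conjBy_apply, Matrix.mul_apply, Fintype.sum_prod_type, Matrix.one_apply,
    apply_ite]

lemma isChannel_conjBy {A : Type} [Fintype A] [DecidableEq A] {U : Matrix A A ℂ}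
    (hU : Uᴴ * U = 1) : IsChannel (conjBy U) := by
  classical
  refine ⟨fun M => ?_, fun E _ ρ hρ => ?_⟩
  · rw [conjBy_apply, trace_mul_comm, mul_assoc, hU, mul_one]
  · rw [ampliation_conjBy]
    exact hρ.mul_mul_conjTranspose_same _

lemma ambainisSmith_eq {K : Type} {n : ℕ} (s : K → Fin (n + n) → ZMod 2) (k : K) :
    ambainisSmith s k = conjBy (A := Fin n → Fin 2) (pauli (xPart (s k)) (zPart (s k))) := by
  change LinearMap.mulLeft ℂ (tensorPow pauliX (xPart (s k)) * tensorPow pauliZ (zPart (s k))) ∘ₗ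
    LinearMap.mulRight ℂ (tensorPow pauliZ (zPart (s k)) * tensorPow pauliX (xPart (s k))) = _
  rw [tensorPow_pauliX_mul_pauliZ, tensorPow_pauliZ_mul_pauliX]
  rfl

/-- Encryption by Pauli operators is inverted by the adjoint Pauli operators. -/
theorem isEncryptionScheme_ambainisSmith {K : Type} {n : ℕ} (s : K → Fin (n + n) → ZMod 2) :
    IsEncryptionScheme (ambainisSmith s) := by
  intro k
  rw [ambainisSmith_eq]
  set U : Matrix (Fin n → Fin 2) (Fin n → Fin 2) ℂ := pauli (xPart (s k)) (zPart (s k)) with hU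
  have h1 : Uᴴ * U = 1 := pauli_conjTranspose_mul _ _
  have h2 : U * Uᴴ = 1 := pauli_mul_conjTranspose _ _
  refine ⟨isChannel_conjBy h1, conjBy Uᴴ, isChannel_conjBy ?_, fun E _ ρ _ => ?_⟩
  · rw [conjTranspose_conjTranspose, h2]
  · rw [ampliation_comp]
    convert ampliation_id ρ
    ext1 M
    rw [LinearMap.comp_apply, conjBy_apply, conjBy_apply, conjTranspose_conjTranspose,
      LinearMap.id_apply, mul_assoc, mul_assoc, h1, mul_one, ← mul_assoc, h1, one_mul]

/-! ### The Hilbert–Schmidt norm -/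

/-- The square of the Hilbert–Schmidt norm. -/
def hsSq {A : Type} [Fintype A] (M : Matrix A A ℂ) : ℝ := ∑ x, ∑ y, ‖M x y‖ ^ 2

lemma hsSq_nonneg {A : Type} [Fintype A] (M : Matrix A A ℂ) : 0 ≤ hsSq M := by
  unfold hsSq; positivity

lemma hsSq_eq_trace {A : Type} [Fintype A] (M : Matrix A A ℂ) : hsSq M = (M * Mᴴ).trace.re := by
  simp only [hsSq, Matrix.trace, Matrix.diag, Matrix.mul_apply, conjTranspose_apply,
    Complex.re_sum, Complex.star_def, Complex.mul_conj, Complex.normSq_eq_norm_sq,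
    Complex.ofReal_re]

lemma norm_trace_mul_sq_le {A : Type} [Fintype A] (M N : Matrix A A ℂ) :
    ‖(M * N).trace‖ ^ 2 ≤ hsSq M * hsSq N := by
  have h1 : ‖(M * N).trace‖ ≤ ∑ p : A × A, ‖M p.1 p.2‖ * ‖N p.2 p.1‖ := by
    rw [Fintype.sum_prod_type]
    simp only [Matrix.trace, Matrix.diag, Matrix.mul_apply]
    refine (norm_sum_le _ _).trans (Finset.sum_le_sum fun x _ => ?_)
    refine (norm_sum_le _ _).trans (Finset.sum_le_sum fun y _ => ?_)
    rw [norm_mul]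
  have h2 := Finset.sum_mul_sq_le_sq_mul_sq (Finset.univ (α := A × A))
    (fun p => ‖M p.1 p.2‖) (fun p => ‖N p.2 p.1‖)
  calc ‖(M * N).trace‖ ^ 2 ≤ (∑ p : A × A, ‖M p.1 p.2‖ * ‖N p.2 p.1‖) ^ 2 := by gcongr
    _ ≤ _ := h2
    _ = hsSq M * hsSq N := by
      rw [Fintype.sum_prod_type, Fintype.sum_prod_type, hsSq, hsSq]
      congr 1
      exact Finset.sum_comm

/-- Writing `M = C† C`, cyclicity turns the trace into that of the positive operator `C N C†`. -/
lemma re_trace_mul_nonneg {A : Type} [Fintype A] [DecidableEq A] {M N : Matrix A A ℂ}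
    (hM : M.PosSemidef) (hN : N.PosSemidef) : 0 ≤ (M * N).trace.re := by
  obtain ⟨C, rfl⟩ := CStarAlgebra.nonneg_iff_eq_star_mul_self.mp hM.nonneg
  rw [mul_assoc, trace_mul_comm, star_eq_conjTranspose]
  exact (Complex.nonneg_iff.1 (hN.mul_mul_conjTranspose_same C).trace_nonneg).1

/-- The squared Hilbert–Schmidt norm is the sum over the `E`-blocks, and `Φ` acts block by block, so
the constant does not grow with `E`. -/
lemma hsSq_ampliation_le {A E : Type} [Fintype A] [Fintype E]
    {Φ : Matrix A A ℂ →ₗ[ℂ] Matrix A A ℂ} {c : ℝ} (hΦ : ∀ M, hsSq (Φ M) ≤ c * hsSq M)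
    (M : Matrix (A × E) (A × E) ℂ) : hsSq (ampliation Φ M) ≤ c * hsSq M := by
  have h : ∀ N : Matrix (A × E) (A × E) ℂ,
      hsSq N = ∑ e, ∑ e', hsSq (Matrix.of fun a a' => N (a, e) (a', e')) := by
    intro N
    simp only [hsSq, Fintype.sum_prod_type_right, Matrix.of_apply]
    refine Finset.sum_congr rfl fun e _ => ?_
    rw [Finset.sum_comm]
  rw [h, h M, Finset.mul_sum]
  refine Finset.sum_le_sum fun e _ => ?_
  rw [Finset.mul_sum]
  exact Finset.sum_le_sum fun e' _ => hΦ (Matrix.of fun a a' => M (a, e) (a', e'))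

/-! ### Deviation of the Ambainis–Smith scheme from the completely depolarizing channel -/

/-- The averaged Ambainis–Smith channel minus the completely depolarizing channel. -/
def deviation {K : Type} [Fintype K] {n : ℕ} (s : K → Fin (n + n) → ZMod 2) :
    Matrix (Fin n → Fin 2) (Fin n → Fin 2) ℂ →ₗ[ℂ] Matrix (Fin n → Fin 2) (Fin n → Fin 2) ℂ :=
  (Fintype.card K : ℂ)⁻¹ • ∑ k, ambainisSmith s k
    - ((2 : ℂ) ^ n)⁻¹ • (traceLinearMap (Fin n → Fin 2) ℂ ℂ).smulRight 1

lemma deviation_apply {K : Type} [Fintype K] {n : ℕ} (s : K → Fin (n + n) → ZMod 2)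
    (M : Matrix (Fin n → Fin 2) (Fin n → Fin 2) ℂ) (x y : Fin n → Fin 2) :
    deviation s M x y = (Fintype.card K : ℂ)⁻¹ * ∑ k, ambainisSmith s k M x y
      - ((2 : ℂ) ^ n)⁻¹ * (M.trace * (1 : Matrix (Fin n → Fin 2) (Fin n → Fin 2) ℂ) x y) := by
  simp [deviation, Matrix.sum_apply]

lemma view_sub_eq_ampliation_deviation {K E : Type} [Fintype K] {n : ℕ}
    (s : K → Fin (n + n) → ZMod 2)
    (ρ : Matrix ((Fin n → Fin 2) × E) ((Fin n → Fin 2) × E) ℂ) :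
    view (ambainisSmith s) ρ
      - ((2 : ℂ) ^ n)⁻¹ • ((1 : Matrix (Fin n → Fin 2) (Fin n → Fin 2) ℂ) ⊗ₖ trA ρ)
      = ampliation (deviation s) ρ := by
  ext x y
  simp [view, ampliation, deviation_apply, Matrix.sum_apply, trA, Matrix.trace, mul_comm]

lemma deviation_apply_add {K : Type} [Fintype K] {n : ℕ} (s : K → Fin (n + n) → ZMod 2)
    (M : Matrix (Fin n → ZMod 2) (Fin n → ZMod 2) ℂ) (x z : Fin n → ZMod 2) :
    deviation s M x (x + z) = diagDeviation s z (fun v => M v (v + z)) x := by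
  have h1 : ∀ k, ambainisSmith s k M x (x + z) = sgn ℂ (zPart (s k) ⬝ᵥ z) *
      M (x + xPart (s k)) (x + xPart (s k) + z) := by
    intro k
    rw [ambainisSmith_eq]
    refine (pauli_conj_apply _ _ M x (x + z)).trans ?_
    rw [← add_assoc, bits_add_self, zero_add, add_right_comm]
  have h2 : (1 : Matrix (Fin n → Fin 2) (Fin n → Fin 2) ℂ) x (x + z) = if z = 0 then 1 else 0 := by
    refine (Matrix.one_apply (n := Fin n → ZMod 2) (i := x) (j := x + z)).trans ?_
    simp
  refine (deviation_apply s M x (x + z)).trans ?_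
  rw [Finset.sum_congr rfl fun k _ => h1 k, h2, diagDeviation]
  congr 1
  split_ifs with hz
  · subst hz
    simp only [add_zero, mul_one]
    rfl
  · simp

lemma hsSq_eq_sum_diagonals {n : ℕ} (M : Matrix (Fin n → ZMod 2) (Fin n → ZMod 2) ℂ) :
    hsSq M = ∑ z, ∑ x, ‖M x (x + z)‖ ^ 2 := by
  rw [hsSq, Finset.sum_comm (f := fun z x => ‖M x (x + z)‖ ^ 2)]
  refine Finset.sum_congr rfl fun x _ => ?_
  exact (Equiv.sum_comp (Equiv.addLeft x) fun y => ‖M x y‖ ^ 2).symm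

lemma hsSq_deviation_le {K : Type} [Fintype K] {n : ℕ} {s : K → Fin (n + n) → ZMod 2} {δ : ℝ}
    (hs : IsDeltaBiased δ s) (M : Matrix (Fin n → Fin 2) (Fin n → Fin 2) ℂ) :
    hsSq (deviation s M) ≤ δ ^ 2 * hsSq M := by
  -- The indices are retyped as `ZMod 2` strings to make addition available; the final line returns
  -- to `Fin 2` by definitional equality.
  have h : ∀ M D : Matrix (Fin n → ZMod 2) (Fin n → ZMod 2) ℂ,
      (∀ x z, D x (x + z) = diagDeviation s z (fun v => M v (v + z)) x) →
        hsSq D ≤ δ ^ 2 * hsSq M := by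
    intro M D hD
    rw [hsSq_eq_sum_diagonals M, hsSq_eq_sum_diagonals D, Finset.mul_sum]
    refine Finset.sum_le_sum fun z _ => ?_
    simp_rw [hD]
    exact sum_norm_diagDeviation_sq_le hs z _
  exact h M (deviation s M) fun x z => deviation_apply_add s M x z

/-! ### Weighted Cauchy–Schwarz estimate -/

/-- A positive definite matrix is the fourth power of an invertible Hermitian matrix. -/
lemma exists_fourth_root {E : Type} [Fintype E] [DecidableEq E] {σ : Matrix E E ℂ}
    (hσ : σ.PosDef) : ∃ r r' : Matrix E E ℂ, r.IsHermitian ∧ r'.IsHermitian ∧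
      r * r' = 1 ∧ r' * r = 1 ∧ r * r * (r * r) = σ := by
  set q := CFC.sqrt σ
  have hq : q * q = σ := CFC.sqrt_mul_sqrt_self σ hσ.posSemidef.nonneg
  have hr : CFC.sqrt q * CFC.sqrt q = q := CFC.sqrt_mul_sqrt_self q (CFC.sqrt_nonneg σ)
  set r := CFC.sqrt q
  have hr0 : r.PosSemidef := (CFC.sqrt_nonneg q).posSemidef
  have h4 : r * r * (r * r) = σ := by rw [hr, hq]
  have hdet : IsUnit r.det := by
    have := (Matrix.isUnit_iff_isUnit_det _).1 hσ.isUnit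
    rw [← h4, mul_assoc, det_mul] at this
    exact isUnit_of_mul_isUnit_left this
  exact ⟨r, r⁻¹, hr0.isHermitian, hr0.isHermitian.inv, mul_nonsing_inv _ hdet,
    nonsing_inv_mul _ hdet, h4⟩

lemma isHermitian_one_kronecker {A E : Type} [DecidableEq A] {r : Matrix E E ℂ}
    (hr : r.IsHermitian) : ((1 : Matrix A A ℂ) ⊗ₖ r).IsHermitian := by
  rw [IsHermitian, conjTranspose_kronecker, conjTranspose_one, hr.eq]

/-- The estimate behind both security notions: a superoperator that contracts the Hilbert–Schmidt
norm by `δ` has small overlap with the observables `H y` on operators `T y` of conditional min-entropy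
`-log l`. -/
theorem sq_sum_re_trace_mul_ampliation_le {A E Y : Type} [Fintype A] [DecidableEq A] [Fintype E]
    [DecidableEq E] [Fintype Y] {Φ : Matrix A A ℂ →ₗ[ℂ] Matrix A A ℂ} {δ l : ℝ}
    (hΦ : ∀ M, hsSq (Φ M) ≤ δ ^ 2 * hsSq M) {σ : Matrix E E ℂ} (hσ : σ.PosDef)
    (hσ1 : σ.trace = 1) {T H : Y → Matrix (A × E) (A × E) ℂ} (hT : ∀ y, (T y).PosSemidef)
    (hTl : ∀ y, ((l : ℂ) • ((1 : Matrix A A ℂ) ⊗ₖ σ) - T y).PosSemidef)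
    (hT1 : ∑ y, (T y).trace.re = 1) (hHh : ∀ y, (H y).IsHermitian)
    (hH : ∀ S : Matrix (A × E) (A × E) ℂ, S.IsHermitian →
      ∑ y, (H y * S * H y * S).trace.re ≤ (S * S).trace.re) :
    (∑ y, (H y * ampliation Φ (T y)).trace.re) ^ 2 ≤ δ ^ 2 * (Fintype.card A * l) := by
  obtain ⟨r, r', hr, hr', hrr', hr'r, h4⟩ := exists_fourth_root hσ
  -- `R` stands for `𝕀 ⊗ σ^{1/4}` and `R'` for its inverse. The observables are weighted by `R` on
  -- both sides and the operators by `R'` on both sides, which leaves their pairing unchanged.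
  set R : Matrix (A × E) (A × E) ℂ := (1 : Matrix A A ℂ) ⊗ₖ r with hR
  set R' : Matrix (A × E) (A × E) ℂ := (1 : Matrix A A ℂ) ⊗ₖ r' with hR'
  have hRh : R.IsHermitian := isHermitian_one_kronecker hr
  have hR'h : R'.IsHermitian := isHermitian_one_kronecker hr'
  have hRR' : R * R' = 1 := by rw [← mul_kronecker_mul, one_mul, hrr', one_kronecker_one]
  have hR'R : R' * R = 1 := by rw [← mul_kronecker_mul, one_mul, hr'r, one_kronecker_one]
  have hR4 : R * R * (R * R) = (1 : Matrix A A ℂ) ⊗ₖ σ := by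
    rw [← mul_kronecker_mul, ← mul_kronecker_mul, one_mul, one_mul, h4]
  have hSh : (R * R).IsHermitian := by
    rw [IsHermitian, conjTranspose_mul, hRh.eq]
  have hS'h : (R' * R').IsHermitian := by
    rw [IsHermitian, conjTranspose_mul, hR'h.eq]
  -- the observables
  have hbH : ∑ y, hsSq (R * H y * R) ≤ Fintype.card A := by
    have h1 : ∀ y, hsSq (R * H y * R) = (H y * (R * R) * H y * (R * R)).trace.re := by
      intro y
      rw [hsSq_eq_trace, conjTranspose_mul, conjTranspose_mul, hRh.eq, (hHh y).eq]
      rw [show R * H y * R * (R * (H y * R)) = R * (H y * (R * R) * H y * R) by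
        simp only [mul_assoc], trace_mul_comm]
      simp only [mul_assoc]
    rw [Finset.sum_congr rfl fun y _ => h1 y]
    -- The hypothesis on the observables is used at `S = R²`, for which `S² = 𝕀 ⊗ σ` has trace
    -- `|A|`.
    refine (hH _ hSh).trans_eq ?_
    rw [hR4, trace_kronecker, hσ1, trace_one, mul_one]
    simp
  -- the operators
  have hbT : ∑ y, hsSq (R' * T y * R') ≤ l := by
    have h1 : ∀ y, hsSq (R' * T y * R') ≤ l * (T y).trace.re := by
      intro y
      have h2 : hsSq (R' * T y * R') = (T y * (R' * R' * T y * (R' * R'))).trace.re := by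
        rw [hsSq_eq_trace, conjTranspose_mul, conjTranspose_mul, hR'h.eq, (hT y).isHermitian.eq]
        rw [show R' * T y * R' * (R' * (T y * R')) = R' * (T y * (R' * R') * T y * R') by
          simp only [mul_assoc], trace_mul_comm]
        simp only [mul_assoc]
      -- Conjugating `T y ≤ l 𝕀 ⊗ σ` by `𝕀 ⊗ σ^{-1/2}` gives an upper bound `l 𝕀`, which is then
      -- paired with `T y ≥ 0`.
      have h3 :
          ((R' * R') * ((l : ℂ) • ((1 : Matrix A A ℂ) ⊗ₖ σ) - T y) * (R' * R')).PosSemidef := by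
        have := (hTl y).mul_mul_conjTranspose_same (R' * R')
        rwa [hS'h.eq] at this
      have h4 : (R' * R') * ((l : ℂ) • ((1 : Matrix A A ℂ) ⊗ₖ σ) - T y) * (R' * R')
          = (l : ℂ) • 1 - R' * R' * T y * (R' * R') := by
        rw [mul_sub, sub_mul, ← hR4, mul_smul_comm, smul_mul_assoc]
        congr 2
        calc R' * R' * (R * R * (R * R)) * (R' * R')
            = R' * ((R' * R) * R) * (R * (R * R') * R') := by simp only [mul_assoc]
          _ = 1 := by rw [hR'R, hRR', one_mul, mul_one, hR'R, hRR', one_mul]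
      have h5 := re_trace_mul_nonneg (hT y) h3
      rw [h4, mul_sub, trace_sub, mul_smul_comm, mul_one, trace_smul, Complex.sub_re, ← h2,
        smul_eq_mul, Complex.re_ofReal_mul] at h5
      linarith
    refine (Finset.sum_le_sum fun y _ => h1 y).trans_eq ?_
    rw [← Finset.mul_sum, hT1, mul_one]
  -- Cauchy–Schwarz
  have hCS : ∀ y, (H y * ampliation Φ (T y)).trace.re ^ 2 ≤
      hsSq (R * H y * R) * (δ ^ 2 * hsSq (R' * T y * R')) := by
    intro y
    have h1 : (H y * ampliation Φ (T y)).trace =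
        ((R * H y * R) * ampliation Φ (R' * T y * R')).trace := by
      rw [ampliation_mul_one_kronecker, ampliation_one_kronecker_mul, ← hR']
      rw [show R * H y * R * (R' * ampliation Φ (T y) * R') =
        R * (H y * (R * R') * ampliation Φ (T y) * R') by simp only [mul_assoc],
        trace_mul_comm R, hRR', mul_one, mul_assoc, mul_assoc, hR'R, mul_one]
    calc (H y * ampliation Φ (T y)).trace.re ^ 2
        ≤ ‖(H y * ampliation Φ (T y)).trace‖ ^ 2 := by
          rw [← sq_abs]
          gcongr
          exact Complex.abs_re_le_norm _
      _ ≤ hsSq (R * H y * R) * hsSq (ampliation Φ (R' * T y * R')) := by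
          rw [h1]; exact norm_trace_mul_sq_le _ _
      _ ≤ _ := by
          gcongr
          · exact hsSq_nonneg _
          · exact hsSq_ampliation_le hΦ _
  calc (∑ y, (H y * ampliation Φ (T y)).trace.re) ^ 2
      ≤ (∑ y, hsSq (R * H y * R)) * ∑ y, δ ^ 2 * hsSq (R' * T y * R') :=
        Finset.sum_sq_le_sum_mul_sum_of_sq_le_mul _ (fun y _ => hsSq_nonneg _)
          (fun y _ => mul_nonneg (sq_nonneg _) (hsSq_nonneg _)) fun y _ => hCS y
    _ ≤ Fintype.card A * (δ ^ 2 * l) := by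
        rw [← Finset.mul_sum]
        gcongr
        exact mul_nonneg (sq_nonneg _) (Finset.sum_nonneg fun y _ => hsSq_nonneg _)
    _ = δ ^ 2 * (Fintype.card A * l) := by ring

lemma inv_natCast_nonneg (m : ℕ) : (0 : ℂ) ≤ (m : ℂ)⁻¹ := by
  simp

lemma inv_two_pow_nonneg (n : ℕ) : (0 : ℂ) ≤ ((2 : ℂ) ^ n)⁻¹ := by
  simp

/-! ### Trace norm and spectral decomposition -/

lemma posSemidef_conjStarAlgAut_diagonal {A : Type} [Fintype A] [DecidableEq A]
    (Q : unitary (Matrix A A ℂ)) {f : A → ℝ} (hf : ∀ i, 0 ≤ f i) :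
    (Unitary.conjStarAlgAut ℂ _ Q (diagonal fun i => (f i : ℂ))).PosSemidef := by
  rw [Unitary.conjStarAlgAut_apply, star_eq_conjTranspose]
  exact (PosSemidef.diagonal fun i => by simpa using hf i).mul_mul_conjTranspose_same _

/-- The trace norm of a Hermitian matrix is its pairing with a Hermitian unitary. -/
lemma exists_traceNorm_eq {A : Type} [Fintype A] [DecidableEq A] {M : Matrix A A ℂ}
    (hM : M.IsHermitian) : ∃ U : Matrix A A ℂ, U.IsHermitian ∧ U * U = 1 ∧
      traceNorm M = (U * M).trace.re := by
  set φ := Unitary.conjStarAlgAut ℂ (Matrix A A ℂ) hM.eigenvectorUnitary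
  set v := hM.eigenvalues
  have hφ : M = φ (diagonal fun i => (v i : ℂ)) := hM.spectral_theorem
  -- The sign at a zero eigenvalue is taken to be 1, so that `U` squares to the identity.
  set U := φ (diagonal fun i => ((if 0 ≤ v i then 1 else -1 : ℝ) : ℂ)) with hU
  have hUM : U * M = φ (diagonal fun i => ((|v i| : ℝ) : ℂ)) := by
    rw [hU, hφ, ← map_mul, diagonal_mul_diagonal]
    congr 2
    funext i
    split_ifs with h
    · rw [abs_of_nonneg h]; simp
    · rw [abs_of_neg (not_le.1 h)]; simp
  have hN : (U * M).PosSemidef := by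
    rw [hUM]
    exact posSemidef_conjStarAlgAut_diagonal _ fun i => abs_nonneg _
  have hNN : U * M * (U * M) = Mᴴ * M := by
    rw [hUM, hM.eq]
    conv_rhs => rw [hφ]
    rw [← map_mul, ← map_mul, diagonal_mul_diagonal, diagonal_mul_diagonal]
    congr 2
    funext i
    rw [← Complex.ofReal_mul, abs_mul_abs_self, Complex.ofReal_mul]
  refine ⟨U, ?_, ?_, ?_⟩
  · rw [IsHermitian, hU, ← star_eq_conjTranspose, ← map_star, star_eq_conjTranspose,
      diagonal_conjTranspose]
    congr 2
    funext i
    simp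
  · rw [hU, ← map_mul, diagonal_mul_diagonal, ← map_one φ, ← diagonal_one]
    congr 2
    funext i
    split_ifs <;> simp
  · rw [traceNorm, CFC.sqrt_unique hNN hN.nonneg]

/-- The eigenvalues are nonnegative and sum to 1, so none exceeds 1. -/
lemma IsState.one_sub_posSemidef {A : Type} [Fintype A] [DecidableEq A] {ρ : Matrix A A ℂ}
    (hρ : IsState ρ) : (1 - ρ).PosSemidef := by
  have hM := hρ.1.isHermitian
  set φ := Unitary.conjStarAlgAut ℂ (Matrix A A ℂ) hM.eigenvectorUnitary
  have hφ : ρ = φ (diagonal fun i => (hM.eigenvalues i : ℂ)) := hM.spectral_theorem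
  have hsum : ∑ i, hM.eigenvalues i = 1 := by
    have := hM.trace_eq_sum_eigenvalues
    rw [hρ.2] at this
    simpa using (congrArg Complex.re this).symm
  have h : 1 - ρ = φ (diagonal fun i => ((1 - hM.eigenvalues i : ℝ) : ℂ)) := by
    conv_lhs => rw [hφ]
    rw [← map_one φ, ← map_sub, ← diagonal_one, diagonal_sub]
    congr 2
    funext i
    simp
  rw [h]
  refine posSemidef_conjStarAlgAut_diagonal _ fun i => ?_
  rw [sub_nonneg, ← hsum]
  exact Finset.single_le_sum (fun j _ => hρ.1.eigenvalues_nonneg j) (Finset.mem_univ i)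

/-! ### Partial trace -/

lemma trA_posSemidef {A E : Type} [Fintype A] {ρ : Matrix (A × E) (A × E) ℂ}
    (hρ : ρ.PosSemidef) : (trA ρ).PosSemidef := by
  have h : trA ρ = ∑ a, ρ.submatrix (fun e => (a, e)) (fun e => (a, e)) := by
    ext e e'
    simp [trA, Matrix.sum_apply]
  rw [h]
  exact posSemidef_sum _ fun a _ => hρ.submatrix _

lemma trace_mul_one_kronecker {A E : Type} [Fintype A] [DecidableEq A] [Fintype E]
    (P : Matrix (A × E) (A × E) ℂ) (τ : Matrix E E ℂ) :
    (P * ((1 : Matrix A A ℂ) ⊗ₖ τ)).trace = (trA P * τ).trace := by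
  simp only [Matrix.trace, Matrix.diag, mul_one_kronecker_apply, Fintype.sum_prod_type_right]
  simp only [Matrix.mul_apply, trA, Matrix.of_apply, Finset.sum_mul]
  exact Finset.sum_congr rfl fun e _ => Finset.sum_comm

/-! ### Conditional min-entropy -/

lemma IsState.nonempty {A : Type} [Fintype A] {ρ : Matrix A A ℂ} (hρ : IsState ρ) : Nonempty A := by
  by_contra h
  rw [not_nonempty_iff] at h
  have := hρ.2
  simp [Matrix.trace] at this

/-- Take traces in the operator inequality. -/
lemma one_le_mul_card_of_le {A E : Type} [Fintype A] [DecidableEq A] [Fintype E]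
    {ρ : Matrix (A × E) (A × E) ℂ} (hρ : IsState ρ) {σ : Matrix E E ℂ} (hσ : IsState σ) {l : ℝ}
    (h : ((l : ℂ) • ((1 : Matrix A A ℂ) ⊗ₖ σ) - ρ).PosSemidef) : 1 ≤ l * Fintype.card A := by
  have h1 := (Complex.nonneg_iff.1 h.trace_nonneg).1
  rw [trace_sub, trace_smul, trace_kronecker, trace_one, hσ.2, hρ.2, mul_one] at h1
  simp at h1
  linarith

/-- An operator of conditional min-entropy at least `t` is dominated by `μ 𝕀 ⊗ σ` with a faithful
state `σ`, for every `μ > 2^{-t}`. -/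
lemma exists_posDef_of_le_condMinEntropy {A E : Type} [Fintype A] [DecidableEq A] [Fintype E]
    [DecidableEq E] {ρ : Matrix (A × E) (A × E) ℂ} (hρ : IsState ρ) {t μ : ℝ}
    (ht : t ≤ condMinEntropy ρ) (hμ : (2 : ℝ) ^ (-t) < μ) :
    ∃ σ : Matrix E E ℂ, σ.PosDef ∧ σ.trace = 1 ∧
      ((μ : ℂ) • ((1 : Matrix A A ℂ) ⊗ₖ σ) - ρ).PosSemidef := by
  obtain ⟨⟨a, e⟩⟩ := hρ.nonempty
  have hA : (0 : ℝ) < Fintype.card A := by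
    exact_mod_cast Fintype.card_pos_iff.2 ⟨a⟩
  have hE : (0 : ℝ) < Fintype.card E := by
    exact_mod_cast Fintype.card_pos_iff.2 ⟨e⟩
  have hEc : (Fintype.card E : ℂ) ≠ 0 := by exact_mod_cast hE.ne'
  rw [condMinEntropy] at ht
  set L : Set ℝ := {l : ℝ | ∃ σ : Matrix E E ℂ, IsState σ ∧
    ((l : ℂ) • ((1 : Matrix A A ℂ) ⊗ₖ σ) - ρ).PosSemidef} with hL
  -- A positive lower bound for all feasible `l`, so that `logb` is evaluated at a positive infimum
  -- and not at a default value.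
  have hbd : ∀ l ∈ L, (Fintype.card A : ℝ)⁻¹ ≤ l := by
    rintro l ⟨σ, hσ, h⟩
    rw [inv_le_iff_one_le_mul₀ hA]
    exact one_le_mul_card_of_le hρ hσ h
  have hne : L.Nonempty := by
    -- Since `ρ ≤ 𝕀`, the maximally mixed state of `E` is feasible with `l = |E|`.
    refine ⟨Fintype.card E, (Fintype.card E : ℂ)⁻¹ • 1, ⟨?_, ?_⟩, ?_⟩
    · exact PosSemidef.one.smul (inv_natCast_nonneg _)
    · rw [trace_smul, trace_one, smul_eq_mul, inv_mul_cancel₀ hEc]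
    · rw [kronecker_smul, one_kronecker_one, smul_smul, Complex.ofReal_natCast,
        mul_inv_cancel₀ hEc, one_smul]
      exact hρ.one_sub_posSemidef
  have hpos : 0 < sInf L := (inv_pos.2 hA).trans_le (le_csInf hne hbd)
  have hle : sInf L ≤ (2 : ℝ) ^ (-t) :=
    (Real.logb_le_iff_le_rpow one_lt_two hpos).1 (by linarith)
  obtain ⟨l, hlL, hlμ⟩ := exists_lt_of_csInf_lt hne (hle.trans_lt hμ)
  have hl0 : 0 < l := (inv_pos.2 hA).trans_le (hbd l hlL)
  obtain ⟨σ, hσ, h⟩ := hlL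
  have hμ0 : 0 < μ := hl0.trans hlμ
  have hμc : (μ : ℂ) ≠ 0 := by exact_mod_cast hμ0.ne'
  -- The slack `μ - l` is spread evenly over `E`: this makes the operator faithful and brings its
  -- trace up to `μ`.
  set η : ℝ := (μ - l) / Fintype.card E with hη
  have hη0 : 0 < η := div_pos (sub_pos.2 hlμ) hE
  have hηE : l + η * Fintype.card E = μ := by
    rw [hη, div_mul_cancel₀ _ hE.ne']; ring
  refine ⟨(μ : ℂ)⁻¹ • ((l : ℂ) • σ + (η : ℂ) • 1), ?_, ?_, ?_⟩
  · refine PosDef.smul (PosDef.posSemidef_add (hσ.1.smul ?_) (PosDef.one.smul ?_)) ?_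
    · exact_mod_cast hl0.le
    · exact_mod_cast hη0
    · exact_mod_cast inv_pos.2 hμ0
  · rw [trace_smul, trace_add, trace_smul, trace_smul, hσ.2, trace_one, smul_eq_mul, smul_eq_mul,
      smul_eq_mul, mul_one, inv_mul_eq_one₀ hμc]
    exact_mod_cast hηE.symm
  · rw [kronecker_smul, smul_smul, mul_inv_cancel₀ hμc, one_smul, kronecker_add, kronecker_smul,
      kronecker_smul, one_kronecker_one, add_sub_right_comm]
    refine h.add (PosSemidef.one.smul ?_)
    exact_mod_cast hη0.le

/-! ### Trace-norm bound -/

lemma view_posSemidef {K A B E : Type} [Fintype K] [Fintype A] [Fintype B] [Fintype E]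
    {enc : K → Matrix A A ℂ →ₗ[ℂ] Matrix B B ℂ} (henc : IsEncryptionScheme enc)
    {ρ : Matrix (A × E) (A × E) ℂ} (hρ : ρ.PosSemidef) : (view enc ρ).PosSemidef :=
  (posSemidef_sum _ fun k _ => (henc k).1.2 E ρ hρ).smul (inv_natCast_nonneg _)

lemma isHermitian_ampliation_deviation {K E : Type} [Fintype K] [Fintype E] {n : ℕ}
    (s : K → Fin (n + n) → ZMod 2)
    {ρ : Matrix ((Fin n → Fin 2) × E) ((Fin n → Fin 2) × E) ℂ} (hρ : ρ.PosSemidef) :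
    (ampliation (deviation s) ρ).IsHermitian := by
  rw [← view_sub_eq_ampliation_deviation]
  refine (view_posSemidef (isEncryptionScheme_ambainisSmith s) hρ).isHermitian.sub ?_
  rw [IsHermitian, conjTranspose_smul,
    (isHermitian_one_kronecker (trA_posSemidef hρ).isHermitian).eq]
  simp

/-- The domination by a faithful state is available only for `μ > 2^{-t}`; letting `μ` decrease to
the limit recovers the sharp constant. -/
lemma le_sqrt_of_forall_sq_le {a δ d c : ℝ} (hδ : 0 ≤ δ)
    (h : ∀ μ, c < μ → a ^ 2 ≤ δ ^ 2 * (d * μ)) : |a| ≤ δ * Real.sqrt (d * c) := by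
  have hlim : Filter.Tendsto (fun μ => δ ^ 2 * (d * μ)) (nhdsWithin c (Set.Ioi c))
      (nhds (δ ^ 2 * (d * c))) :=
    ((continuous_const.mul (continuous_const.mul continuous_id)).tendsto c).mono_left
      nhdsWithin_le_nhds
  have h1 : a ^ 2 ≤ δ ^ 2 * (d * c) :=
    ge_of_tendsto hlim (Filter.eventually_of_mem self_mem_nhdsWithin fun μ hμ => h μ hμ)
  have h2 := Real.abs_le_sqrt h1
  rwa [Real.sqrt_mul (sq_nonneg δ), Real.sqrt_sq hδ] at h2

lemma card_qubits (n : ℕ) : (Fintype.card (Fin n → Fin 2) : ℝ) = 2 ^ n := by simp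

/-- The trace-norm bound for `δ`-biased families. -/
theorem traceNorm_ampliation_deviation_le {K E : Type} [Fintype K] [Fintype E] [DecidableEq E]
    {n : ℕ} {s : K → Fin (n + n) → ZMod 2} {δ : ℝ} (hδ : 0 ≤ δ) (hs : IsDeltaBiased δ s)
    {ρ : Matrix ((Fin n → Fin 2) × E) ((Fin n → Fin 2) × E) ℂ} {t : ℝ} (hρ : IsState ρ)
    (ht : t ≤ condMinEntropy ρ) :
    traceNorm (ampliation (deviation s) ρ) ≤ δ * Real.sqrt ((2 : ℝ) ^ n * (2 : ℝ) ^ (-t)) := by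
  obtain ⟨U, hU, hUU, htr⟩ := exists_traceNorm_eq (isHermitian_ampliation_deviation s hρ.1)
  rw [htr]
  refine (le_abs_self _).trans (le_sqrt_of_forall_sq_le hδ fun μ hμ => ?_)
  obtain ⟨σ, hσ, hσ1, hle⟩ := exists_posDef_of_le_condMinEntropy hρ ht hμ
  have h := sq_sum_re_trace_mul_ampliation_le (Y := Unit) (hsSq_deviation_le hs) hσ hσ1
    (T := fun _ => ρ) (H := fun _ => U) (fun _ => hρ.1) (fun _ => hle) (by simp [hρ.2])
    (fun _ => hU) fun S hS => ?_
  · simpa only [Finset.univ_unique, Finset.sum_const, Finset.card_singleton, one_smul,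
      card_qubits] using h
  · simp only [Finset.univ_unique, Finset.sum_const, Finset.card_singleton, one_smul]
    -- Since `U` is a Hermitian unitary, `U S` and `S` have the same Hilbert–Schmidt norm, and
    -- Cauchy–Schwarz bounds the trace of `(U S)²` by its square.
    have h1 : hsSq (U * S) = (S * S).trace.re := by
      rw [hsSq_eq_trace, conjTranspose_mul, hU.eq, hS.eq, trace_mul_comm, mul_assoc,
        ← mul_assoc U, hUU, one_mul]
    have h2 := norm_trace_mul_sq_le (U * S) (U * S)
    rw [← sq (hsSq _), h1] at h2
    rw [mul_assoc (U * S)]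
    exact (Complex.re_le_norm _).trans
      (le_of_sq_le_sq h2 (h1 ▸ hsSq_nonneg _))

/-! ### Security of biased families -/

lemma isState_maximallyMixed (n : ℕ) :
    IsState (((2 : ℂ) ^ n)⁻¹ • (1 : Matrix (Fin n → Fin 2) (Fin n → Fin 2) ℂ)) := by
  refine ⟨PosSemidef.one.smul (inv_two_pow_nonneg n), ?_⟩
  rw [trace_smul, trace_one]
  simp

theorem isIndistinguishable_of_isDeltaBiased {K : Type} [Fintype K] {n : ℕ}
    {s : K → Fin (n + n) → ZMod 2} {δ t ε : ℝ} (hδ : 0 ≤ δ) (hs : IsDeltaBiased δ s)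
    (hε : δ * Real.sqrt ((2 : ℝ) ^ n * (2 : ℝ) ^ (-t)) < ε) :
    IsIndistinguishable (ambainisSmith s) t ε := by
  refine ⟨_, isState_maximallyMixed n, fun E _ _ ρ hρ ht => ?_⟩
  rw [smul_kronecker, view_sub_eq_ampliation_deviation]
  exact (traceNorm_ampliation_deviation_le hδ hs hρ ht).trans_lt hε

lemma IsPOVM.one_sub_posSemidef {A Y : Type} [Fintype A] [DecidableEq A] [Fintype Y]
    {P : Y → Matrix A A ℂ} (hP : IsPOVM P) (y : Y) : (1 - P y).PosSemidef := by
  classical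
  have h : 1 - P y = ∑ y' ∈ Finset.univ.erase y, P y' := by
    rw [← hP.2, ← Finset.add_sum_erase _ _ (Finset.mem_univ y), add_sub_cancel_left]
  rw [h]
  exact posSemidef_sum _ fun y' _ => hP.1 y'

/-- One of the two factors `P y` is replaced by the larger `𝕀`, and the other is summed to `𝕀`. This
is the condition on observables in the weighted estimate. -/
lemma IsPOVM.sum_re_trace_le {A Y : Type} [Fintype A] [DecidableEq A] [Fintype Y]
    {P : Y → Matrix A A ℂ} (hP : IsPOVM P) {S : Matrix A A ℂ} (hS : S.IsHermitian) :
    ∑ y, (P y * S * P y * S).trace.re ≤ (S * S).trace.re := by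
  have h1 : ∀ y, (P y * S * P y * S).trace.re ≤ (S * P y * S).trace.re := by
    intro y
    have h2 : (S * P y * S).PosSemidef := by
      have := (hP.1 y).mul_mul_conjTranspose_same S
      rwa [hS.eq] at this
    have h3 := re_trace_mul_nonneg (hP.one_sub_posSemidef y) h2
    rw [sub_mul, one_mul, trace_sub, Complex.sub_re, ← mul_assoc, ← mul_assoc] at h3
    linarith
  refine (Finset.sum_le_sum fun y _ => h1 y).trans_eq ?_
  rw [← Complex.re_sum, ← trace_sum, ← Finset.sum_mul, ← Finset.mul_sum, hP.2, mul_one]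

/-- The measurement on `E` obtained by feeding the completely mixed state to a measurement. -/
lemma isPOVM_trA {n : ℕ} {E Y : Type} [Fintype E] [DecidableEq E] [Fintype Y]
    {P : Y → Matrix ((Fin n → Fin 2) × E) ((Fin n → Fin 2) × E) ℂ} (hP : IsPOVM P) :
    IsPOVM fun y => ((2 : ℂ) ^ n)⁻¹ • trA (P y) := by
  refine ⟨fun y => (trA_posSemidef (hP.1 y)).smul (inv_two_pow_nonneg n), ?_⟩
  · have h : ∑ y, trA (P y) = trA (∑ y, P y) := by
      ext e e'
      simp only [trA, Matrix.sum_apply, Matrix.of_apply]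
      exact Finset.sum_comm
    rw [← Finset.smul_sum, h, hP.2]
    ext e e'
    simp [trA, Matrix.one_apply]

/-- The adversary without the ciphertext applies the same measurement to a maximally mixed state in
its place. The two success probabilities then differ by a sum over outcomes of pairings with
`deviation`, to which the weighted estimate applies as a whole. -/
theorem isEntropicallySecure_of_isDeltaBiased {K : Type} [Fintype K] {n : ℕ}
    {s : K → Fin (n + n) → ZMod 2} {δ t ε : ℝ} (hδ : 0 ≤ δ) (hs : IsDeltaBiased δ s)
    (hε : δ * Real.sqrt ((2 : ℝ) ^ n * (2 : ℝ) ^ (-t)) ≤ ε) :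
    IsEntropicallySecure (ambainisSmith s) t ε := by
  classical
  intro E _ _ ρ hρ ht I _ p σ hp hp1 hσ hsum Y _ P hP f
  refine ⟨_, isPOVM_trA hP, ?_⟩
  -- Only the value of `f` matters, so the interpretation is coarsened to one unnormalized operator
  -- per value.
  set T : Y → Matrix ((Fin n → Fin 2) × E) ((Fin n → Fin 2) × E) ℂ :=
    fun y => ∑ i with f i = y, (p i : ℂ) • σ i with hT
  have hpσ : ∀ i, ((p i : ℂ) • σ i).PosSemidef := fun i =>
    (hσ i).1.smul (by exact_mod_cast hp i)
  have hTpos : ∀ y, (T y).PosSemidef := fun y => posSemidef_sum _ fun i _ => hpσ i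
  have hTsum : ∑ y, T y = ρ := by
    rw [← hsum]
    exact Finset.sum_fiberwise _ _ _
  have hTle : ∀ y, (ρ - T y).PosSemidef := by
    intro y
    rw [← hTsum, ← Finset.add_sum_erase _ _ (Finset.mem_univ y), add_sub_cancel_left]
    exact posSemidef_sum _ fun y' _ => hTpos y'
  have hdiff : ∑ i, p i * (P (f i) * view (ambainisSmith s) (σ i)).trace.re
      - ∑ i, p i * (((2 : ℂ) ^ n)⁻¹ • trA (P (f i)) * trA (σ i)).trace.re
      = ∑ y, (P y * ampliation (deviation s) (T y)).trace.re := by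
    rw [← Finset.sum_sub_distrib, ← Finset.sum_fiberwise Finset.univ f]
    refine Finset.sum_congr rfl fun y _ => ?_
    have h1 : ampliation (deviation s) (T y) =
        ∑ i with f i = y, (p i : ℂ) • ampliation (deviation s) (σ i) := by
      simp only [← ampliationₗ_apply, hT, map_sum, map_smul]
    rw [h1, Finset.mul_sum, trace_sum, Complex.re_sum]
    refine Finset.sum_congr rfl fun i hi => ?_
    rw [(Finset.mem_filter.1 hi).2, ← view_sub_eq_ampliation_deviation, mul_smul_comm, trace_smul,
      smul_eq_mul, Complex.re_ofReal_mul, mul_sub, trace_sub, Complex.sub_re, mul_sub,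
      mul_smul_comm, trace_smul, trace_mul_one_kronecker, smul_mul_assoc, trace_smul]
  rw [hdiff]
  refine (le_sqrt_of_forall_sq_le hδ fun μ hμ => ?_).trans hε
  obtain ⟨τ, hτ, hτ1, hle⟩ := exists_posDef_of_le_condMinEntropy hρ ht hμ
  rw [← card_qubits]
  refine sq_sum_re_trace_mul_ampliation_le (hsSq_deviation_le hs) hτ hτ1 hTpos (fun y => ?_) ?_
    (fun y => (hP.1 y).isHermitian) fun S hS => hP.sum_re_trace_le hS
  -- Each piece inherits the domination: `T y ≤ ρ ≤ μ 𝕀 ⊗ τ`.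
  · have := hle.add (hTle y)
    rwa [sub_add_sub_cancel] at this
  · rw [← Complex.re_sum, ← trace_sum, hTsum, hρ.2, Complex.one_re]

/-! ### The powering construction -/

/-- By bilinearity the character at `w` sees `y` only through its inner product with the value at
`x` of the polynomial with coefficients `w`. -/
lemma aghp_dotProduct {m N : ℕ} (β : Module.Basis (Fin m) (ZMod 2) (GaloisField 2 m))
    (x y : Fin m → ZMod 2) (w : Fin N → ZMod 2) :
    aghp β N (x, y) ⬝ᵥ w =
      y ⬝ᵥ β.equivFun (∑ i : Fin N, w i • β.equivFun.symm x ^ (i : ℕ)) := by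
  simp only [map_sum, map_smul, dotProduct_sum, dotProduct_smul]
  simp only [dotProduct, aghp, smul_eq_mul]
  refine Finset.sum_congr rfl fun i _ => ?_
  rw [mul_comm]
  congr 1
  exact Finset.sum_congr rfl fun j _ => mul_comm _ _

/-- The number of zeros in `GF(2^m)` of a nonzero polynomial of degree less than `N` with
coefficients in `GF(2)`. -/
lemma card_zeros_le {m N : ℕ} (β : Module.Basis (Fin m) (ZMod 2) (GaloisField 2 m))
    (w : Fin N → ZMod 2) (hw : w ≠ 0) :
    (Finset.univ.filter fun x : Fin m → ZMod 2 =>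
      β.equivFun (∑ i : Fin N, w i • β.equivFun.symm x ^ (i : ℕ)) = 0).card ≤ N - 1 := by
  classical
  set p : Polynomial (GaloisField 2 m) :=
    ∑ i : Fin N, Polynomial.monomial (i : ℕ) (algebraMap (ZMod 2) (GaloisField 2 m) (w i)) with hp
  have hp0 : p ≠ 0 := by
    obtain ⟨i, hi⟩ := Function.ne_iff.mp hw
    intro h
    have hc : p.coeff i = algebraMap (ZMod 2) (GaloisField 2 m) (w i) := by
      rw [hp, Polynomial.finsetSum_coeff, Finset.sum_eq_single i]
      · simp
      · intro j _ hj
        rw [Polynomial.coeff_monomial, if_neg fun h => hj (Fin.ext h)]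
      · simp
    rw [h, Polynomial.coeff_zero] at hc
    exact hi ((map_eq_zero _).1 hc.symm)
  have hdeg : p.natDegree ≤ N - 1 := by
    refine Polynomial.natDegree_sum_le_of_forall_le _ _ fun i _ => ?_
    exact (Polynomial.natDegree_monomial_le _).trans (Nat.le_sub_one_of_lt i.2)
  have heval : ∀ z, p.eval z = ∑ i : Fin N, w i • z ^ (i : ℕ) := by
    intro z
    simp [hp, Polynomial.eval_finsetSum, Algebra.smul_def]
  calc _ ≤ p.roots.toFinset.card := by
        refine Finset.card_le_card_of_injOn β.equivFun.symm (fun x hx => ?_)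
          β.equivFun.symm.injective.injOn
        have hx := (Finset.mem_filter.1 hx).2
        simp only [Finset.mem_coe, Multiset.mem_toFinset, Polynomial.mem_roots hp0,
          Polynomial.IsRoot.def, heval]
        exact (LinearEquiv.map_eq_zero_iff _).1 hx
    _ ≤ p.roots.card := Multiset.toFinset_card_le _
    _ ≤ p.natDegree := Polynomial.card_roots' p
    _ ≤ N - 1 := hdeg

/-- The powering construction has bias at most `(N - 1) / 2^m`. -/
theorem isDeltaBiased_aghp {m N : ℕ} (hN : 1 ≤ N)
    (β : Module.Basis (Fin m) (ZMod 2) (GaloisField 2 m)) :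
    IsDeltaBiased (((N : ℝ) - 1) / 2 ^ m) (aghp β N) := by
  classical
  refine isDeltaBiased_iff.2 ⟨inferInstance, fun w hw => ?_⟩
  -- For fixed `x` the sum over `y` is `2^m` if the polynomial vanishes at `x` and 0 otherwise, so
  -- the bias is the proportion of zeros.
  have h : bias (aghp β N) w = ((Finset.univ.filter fun x : Fin m → ZMod 2 =>
      β.equivFun (∑ i : Fin N, w i • β.equivFun.symm x ^ (i : ℕ)) = 0).card : ℝ) / 2 ^ m := by
    rw [bias, Fintype.sum_prod_type]
    simp only [aghp_dotProduct, sum_sgn_dotProduct_eq_ite, Finset.sum_ite, Finset.sum_const_zero,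
      add_zero, Finset.sum_const, nsmul_eq_mul, Fintype.card_prod, Fintype.card_fun, ZMod.card,
      Fintype.card_fin]
    push_cast
    field_simp
  rw [h, abs_of_nonneg (by positivity)]
  gcongr
  have h1 := card_zeros_le β w hw
  have h2 : ((N - 1 : ℕ) : ℝ) = (N : ℝ) - 1 := by push_cast [hN]; ring
  rw [← h2]
  exact_mod_cast h1

/-! ### Existence of small-bias sets -/

lemma coeff_prod_one_add {V : Type} [Fintype V] [DecidableEq V] (g : V → ℝ) (M : ℕ) :
    (∏ v, (1 + Polynomial.C (g v) * Polynomial.X)).coeff M =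
      ∑ T ∈ Finset.powersetCard M Finset.univ, ∏ v ∈ T, g v := by
  rw [Finset.prod_one_add, Polynomial.finsetSum_coeff, Finset.powersetCard_eq_filter,
    Finset.sum_filter]
  refine Finset.sum_congr rfl fun T _ => ?_
  rw [Finset.prod_mul_distrib, Finset.prod_const, ← map_prod, Polynomial.coeff_C_mul_X_pow]
  simp only [eq_comm]

lemma coeff_pow_le {p q : Polynomial ℝ} (hp : ∀ k, 0 ≤ p.coeff k)
    (hpq : ∀ k, p.coeff k ≤ q.coeff k) (H k : ℕ) :
    0 ≤ (p ^ H).coeff k ∧ (p ^ H).coeff k ≤ (q ^ H).coeff k := by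
  induction H generalizing k with
  | zero =>
    rw [pow_zero, pow_zero, Polynomial.coeff_one]
    exact ⟨by split_ifs <;> norm_num, le_rfl⟩
  | succ H ih =>
    rw [pow_succ, pow_succ, Polynomial.coeff_mul, Polynomial.coeff_mul]
    exact ⟨Finset.sum_nonneg fun x _ => mul_nonneg (ih _).1 (hp _),
      Finset.sum_le_sum fun x _ => mul_le_mul (ih _).2 (hpq _) (hp _) ((ih _).1.trans (ih _).2)⟩

/-- The exponential moment of a balanced sign function on a random set of `M` points is at most
that on `M` independent points. -/
lemma sum_powersetCard_exp_le {V : Type} [Fintype V] [DecidableEq V] {χ : V → ℝ}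
    (hχ : ∀ v, χ v = 1 ∨ χ v = -1) (hsum : ∑ v, χ v = 0) (M : ℕ) (l : ℝ) :
    ∑ T ∈ Finset.powersetCard M Finset.univ, Real.exp (l * ∑ v ∈ T, χ v) ≤
      (Fintype.card V).choose M * Real.cosh l ^ M := by
  set c := Real.cosh l with hc
  set P := Finset.univ.filter fun v => χ v = 1
  set Q := Finset.univ.filter fun v => ¬ χ v = 1
  have hQ : ∀ v ∈ Q, χ v = -1 := fun v hv => (hχ v).resolve_left (Finset.mem_filter.1 hv).2
  have hPQ : Q.card = P.card := by
    rw [← Finset.sum_filter_add_sum_filter_not Finset.univ (fun v => χ v = 1),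
      Finset.sum_congr rfl fun v hv => (Finset.mem_filter.1 hv).2, Finset.sum_congr rfl hQ] at hsum
    simp only [Finset.sum_const, nsmul_eq_mul, mul_one, mul_neg] at hsum
    have : (P.card : ℝ) = Q.card := by linarith
    exact_mod_cast this.symm
  have hcard : Fintype.card V = 2 * P.card := by
    have := Finset.card_filter_add_card_filter_not (s := Finset.univ (α := V)) (fun v => χ v = 1)
    rw [Finset.card_univ] at this
    change P.card + Q.card = _ at this
    omega
  -- The balanced sign function pairs each value 1 with a value -1, and each pair contributes the
  -- factor `(1 + e^l X)(1 + e^{-l} X) = 1 + 2cX + X²` to the generating function.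
  have h1 : ∑ T ∈ Finset.powersetCard M Finset.univ, Real.exp (l * ∑ v ∈ T, χ v) =
      ((1 + Polynomial.C (2 * c) * Polynomial.X + Polynomial.X ^ 2) ^ P.card).coeff M := by
    have : ∀ T : Finset V, Real.exp (l * ∑ v ∈ T, χ v) = ∏ v ∈ T, Real.exp (l * χ v) := by
      intro T
      rw [Finset.mul_sum, Real.exp_sum]
    simp_rw [this]
    rw [← coeff_prod_one_add, ← Finset.prod_filter_mul_prod_filter_not Finset.univ
      (fun v => χ v = 1), Finset.prod_congr rfl fun v hv => by
        rw [(Finset.mem_filter.1 hv).2, mul_one],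
      Finset.prod_congr (s₂ := Q) rfl fun v hv => by rw [hQ v hv, mul_neg, mul_one],
      Finset.prod_const, Finset.prod_const, hPQ, ← mul_pow]
    congr 2
    have h2 : (2 * c) = Real.exp l + Real.exp (-l) := by rw [hc, Real.cosh_eq]; ring
    have h3 : Polynomial.C (Real.exp l) * Polynomial.C (Real.exp (-l)) = 1 := by
      rw [← map_mul, ← Real.exp_add, add_neg_cancel, Real.exp_zero, map_one]
    rw [h2, map_add]
    linear_combination (Polynomial.X ^ 2) * h3
  -- Replacing every weight by `c` gives the factor `(1 + cX)²` per pair; it differs from the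
  -- previous one only in the coefficient of `X²`, where `1 ≤ c²`.
  have h2 : ((Fintype.card V).choose M : ℝ) * c ^ M =
      ((1 + Polynomial.C (2 * c) * Polynomial.X + Polynomial.C (c ^ 2) * Polynomial.X ^ 2)
        ^ P.card).coeff M := by
    have h3 := coeff_prod_one_add (V := V) (fun _ => c) M
    rw [Finset.prod_const, Finset.card_univ, hcard, pow_mul,
      Finset.sum_congr rfl fun T hT => by
        rw [Finset.prod_const, (Finset.mem_powersetCard.1 hT).2],
      Finset.sum_const, Finset.card_powersetCard, Finset.card_univ, nsmul_eq_mul] at h3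
    rw [← h3]
    congr 2
    rw [map_mul, map_pow, Polynomial.C_ofNat]
    ring
  have hc1 : 1 ≤ c := Real.one_le_cosh l
  rw [h1, h2]
  refine (coeff_pow_le (fun k => ?_) (fun k => ?_) _ _).2
  · simp only [Polynomial.coeff_add, Polynomial.coeff_one, Polynomial.coeff_C_mul,
      Polynomial.coeff_X, Polynomial.coeff_X_pow]
    have : 0 ≤ c := by linarith
    positivity
  · simp only [Polynomial.coeff_add, Polynomial.coeff_C_mul, Polynomial.coeff_X_pow]
    gcongr
    split_ifs
    · nlinarith
    · simp

/-- The probabilistic method for small-bias sets. -/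
lemma exists_finset_exp_le {N M : ℕ} (hM : M ≤ 2 ^ N) (l : ℝ) :
    ∃ T : Finset (Fin N → ZMod 2), T.card = M ∧ ∀ w : Fin N → ZMod 2, w ≠ 0 →
      Real.exp (l * |∑ v ∈ T, sgn ℝ (v ⬝ᵥ w)|) ≤ 2 ^ N * (2 * Real.cosh l ^ M) := by
  set W := Finset.univ.filter fun w : Fin N → ZMod 2 => w ≠ 0
  -- Both signs of `l` are included, so that `F w T` dominates the exponential of the absolute
  -- value.
  set F : (Fin N → ZMod 2) → Finset (Fin N → ZMod 2) → ℝ := fun w T =>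
    Real.exp (l * ∑ v ∈ T, sgn ℝ (v ⬝ᵥ w)) + Real.exp (-l * ∑ v ∈ T, sgn ℝ (v ⬝ᵥ w)) with hF
  have hV : Fintype.card (Fin N → ZMod 2) = 2 ^ N := by simp
  have hsg : ∀ a, sgn ℝ a = 1 ∨ sgn ℝ a = -1 := fun a => by
    rcases zmod_two_cases a with rfl | rfl
    · exact Or.inl sgn_zero
    · exact Or.inr sgn_one
  have hmom : ∀ w ∈ W, ∑ T ∈ Finset.powersetCard M Finset.univ, F w T ≤
      (2 ^ N).choose M * (2 * Real.cosh l ^ M) := by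
    intro w hw
    have hw := sum_sgn_dotProduct (R := ℝ) w (Finset.mem_filter.1 hw).2
    have h1 := sum_powersetCard_exp_le (fun v => hsg (v ⬝ᵥ w)) hw M l
    have h2 := sum_powersetCard_exp_le (fun v => hsg (v ⬝ᵥ w)) hw M (-l)
    rw [hV] at h1 h2
    rw [Real.cosh_neg] at h2
    rw [hF, Finset.sum_add_distrib]
    linarith
  have hWcard : (W.card : ℝ) ≤ 2 ^ N := by
    have := Finset.card_le_univ W
    rw [hV] at this
    exact_mod_cast this
  have hcosh : 0 < Real.cosh l := Real.cosh_pos l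
  have htot : ∑ T ∈ Finset.powersetCard M Finset.univ, ∑ w ∈ W, F w T ≤
      ∑ T ∈ Finset.powersetCard M (Finset.univ (α := Fin N → ZMod 2)),
        2 ^ N * (2 * Real.cosh l ^ M) := by
    rw [Finset.sum_comm, Finset.sum_const, Finset.card_powersetCard, Finset.card_univ, hV,
      nsmul_eq_mul]
    refine (Finset.sum_le_sum hmom).trans ?_
    rw [Finset.sum_const, nsmul_eq_mul, mul_left_comm]
    gcongr
  -- Some set does no worse than average for the sum over all nonzero `w`; since the terms are
  -- nonnegative, the bound holds for each `w` at once.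
  obtain ⟨T, hT, hle⟩ := Finset.exists_le_of_sum_le
    (Finset.powersetCard_nonempty.2 (by rw [Finset.card_univ, hV]; exact hM)) htot
  refine ⟨T, (Finset.mem_powersetCard.1 hT).2, fun w hw => ?_⟩
  have hpos : ∀ w ∈ W, 0 ≤ F w T := fun w _ => by positivity
  refine le_trans ?_ ((Finset.single_le_sum hpos (by simpa [W] using hw)).trans hle)
  rw [hF]
  rcases abs_cases (∑ v ∈ T, sgn ℝ (v ⬝ᵥ w)) with ⟨h, _⟩ | ⟨h, _⟩
  · rw [h]
    exact le_add_of_nonneg_right (Real.exp_pos _).le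
  · rw [h, mul_neg, ← neg_mul]
    exact le_add_of_nonneg_left (Real.exp_pos _).le

/-- From `e² ≥ 7` and `2 · 4² < 7²`. The inequality fails at `n = 1`, which is why that case is
treated apart in the construction of sets. -/
lemma two_mul_four_pow_lt_exp_sq {n : ℕ} (hn : 2 ≤ n) :
    2 * (4 : ℝ) ^ n < Real.exp ((n : ℝ) ^ 2) := by
  have h7 : (7 : ℝ) ≤ Real.exp 2 := by
    have h := Real.exp_one_gt_d9
    have : Real.exp 2 = Real.exp 1 * Real.exp 1 := by rw [← Real.exp_add]; norm_num
    rw [this]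
    nlinarith
  have hn' : (2 : ℝ) ≤ n := by exact_mod_cast hn
  calc 2 * (4 : ℝ) ^ n < 7 ^ n := by
        obtain ⟨k, rfl⟩ := Nat.exists_eq_add_of_le hn
        rw [pow_add, pow_add]
        have h1 : (4 : ℝ) ^ k ≤ 7 ^ k := by gcongr; norm_num
        have h2 : (0 : ℝ) < 4 ^ k := by positivity
        norm_num
        linarith
    _ ≤ Real.exp 2 ^ n := by gcongr
    _ = Real.exp (n * 2) := by rw [Real.exp_nat_mul]
    _ ≤ Real.exp ((n : ℝ) ^ 2) := by
        rw [Real.exp_le_exp]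
        nlinarith

/-- Sets of size `M ≥ 2 n² / δ²` and bias less than `δ` exist. -/
lemma exists_finset_bias_lt {n M : ℕ} (hn : 2 ≤ n) (hM : M ≤ 2 ^ (n + n)) {δ : ℝ}
    (hδ : 0 < δ) (hδM : 2 * (n : ℝ) ^ 2 ≤ δ ^ 2 * M) :
    ∃ T : Finset (Fin (n + n) → ZMod 2), T.card = M ∧ ∀ w : Fin (n + n) → ZMod 2, w ≠ 0 →
      |∑ v ∈ T, sgn ℝ (v ⬝ᵥ w)| < δ * M := by
  -- The parameter `l = δ` minimizes the Chernoff exponent `l²M/2 - lδM` that comes from `cosh l ≤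
  -- exp (l²/2)`.
  obtain ⟨T, hT, h⟩ := exists_finset_exp_le hM δ
  refine ⟨T, hT, fun w hw => ?_⟩
  by_contra! hcon
  have h1 : Real.exp (δ ^ 2 * M) ≤ 2 ^ (n + n) * (2 * Real.exp (δ ^ 2 * M / 2)) := by
    calc Real.exp (δ ^ 2 * M) ≤ Real.exp (δ * |∑ v ∈ T, sgn ℝ (v ⬝ᵥ w)|) := by
          rw [Real.exp_le_exp, sq, mul_assoc]
          gcongr
      _ ≤ 2 ^ (n + n) * (2 * Real.cosh δ ^ M) := h w hw
      _ ≤ 2 ^ (n + n) * (2 * Real.exp (δ ^ 2 / 2) ^ M) := by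
          gcongr
          exact Real.cosh_le_exp_half_sq δ
      _ = 2 ^ (n + n) * (2 * Real.exp (δ ^ 2 * M / 2)) := by
          rw [← Real.exp_nat_mul]
          ring_nf
  have h2 : Real.exp (δ ^ 2 * M) = Real.exp (δ ^ 2 * M / 2) * Real.exp (δ ^ 2 * M / 2) := by
    rw [← Real.exp_add]; ring_nf
  have h3 : Real.exp (δ ^ 2 * M / 2) ≤ 2 * 4 ^ n := by
    have h4 := Real.exp_pos (δ ^ 2 * M / 2)
    have h5 : (2 : ℝ) ^ (n + n) = 4 ^ n := by rw [← two_mul, pow_mul]; norm_num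
    rw [h2, h5, ← mul_assoc] at h1
    linarith [le_of_mul_le_mul_right h1 h4]
  have h4 : Real.exp ((n : ℝ) ^ 2) ≤ Real.exp (δ ^ 2 * M / 2) := by
    rw [Real.exp_le_exp]; linarith
  linarith [two_mul_four_pow_lt_exp_sq hn]

/-! ### Key length -/

lemma two_rpow_half_sq (n : ℕ) (t : ℝ) :
    ((2 : ℝ) ^ (((n : ℝ) - t) / 2)) ^ 2 = (2 : ℝ) ^ n * (2 : ℝ) ^ (-t) := by
  rw [sq, ← Real.rpow_add two_pos, add_halves, sub_eq_add_neg, Real.rpow_add two_pos,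
    Real.rpow_natCast]

lemma bias_bound_mul_sqrt (n : ℕ) (t ε : ℝ) :
    ε / (2 : ℝ) ^ (((n : ℝ) - t) / 2) * Real.sqrt ((2 : ℝ) ^ n * (2 : ℝ) ^ (-t)) = ε := by
  have h : (0 : ℝ) < (2 : ℝ) ^ (((n : ℝ) - t) / 2) := by positivity
  rw [← two_rpow_half_sq, Real.sqrt_sq h.le, div_mul_cancel₀ _ h.ne']

/-- This identity is the origin of `κ`: a key of `2m ≥ κ` bits makes `2n/2^m` at most the target
bias. -/
lemma two_rpow_keyLength {n : ℕ} (hn : 1 ≤ n) (t : ℝ) {ε : ℝ} (hε : 0 < ε) :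
    (ε / (2 : ℝ) ^ (((n : ℝ) - t) / 2)) ^ 2 * (2 : ℝ) ^ keyLength n t ε = 4 * (n : ℝ) ^ 2 := by
  have hn' : (0 : ℝ) < n := by exact_mod_cast hn
  have h2 : ∀ x : ℝ, 0 < x → (2 : ℝ) ^ (2 * Real.logb 2 x) = x ^ 2 := by
    intro x hx
    rw [mul_comm, Real.rpow_mul two_pos.le, Real.rpow_logb two_pos (by norm_num) hx]
    norm_num
  have h : (2 : ℝ) ^ keyLength n t ε =
      ((2 : ℝ) ^ (((n : ℝ) - t) / 2)) ^ 2 * (n : ℝ) ^ 2 * (1 / ε) ^ 2 * 4 := by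
    rw [keyLength, Real.rpow_add two_pos, Real.rpow_add two_pos, Real.rpow_add two_pos,
      h2 _ hn', h2 _ (one_div_pos.2 hε), sq ((2 : ℝ) ^ (((n : ℝ) - t) / 2)),
      ← Real.rpow_add two_pos, add_halves]
    norm_num
  rw [h]
  have : (0 : ℝ) < (2 : ℝ) ^ (((n : ℝ) - t) / 2) := by positivity
  field_simp

lemma two_mul_div_two_pow_le {n m : ℕ} (hn : 1 ≤ n) {t ε : ℝ} (hε : 0 < ε)
    (hm : keyLength n t ε ≤ 2 * m) :
    (2 * n : ℝ) / 2 ^ m ≤ ε / (2 : ℝ) ^ (((n : ℝ) - t) / 2) := by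
  have h := two_rpow_keyLength hn t hε
  have hδ : 0 < ε / (2 : ℝ) ^ (((n : ℝ) - t) / 2) := by positivity
  set δ := ε / (2 : ℝ) ^ (((n : ℝ) - t) / 2)
  have h1 : (2 : ℝ) ^ keyLength n t ε ≤ (2 ^ m) ^ 2 := by
    refine (Real.rpow_le_rpow_of_exponent_le one_le_two hm).trans_eq ?_
    rw [← pow_mul, ← Real.rpow_natCast]
    push_cast
    rw [mul_comm]
  rw [div_le_iff₀ (by positivity)]
  refine le_of_sq_le_sq ?_ (by positivity)
  rw [mul_pow, mul_pow, show (2 : ℝ) ^ 2 = 4 by norm_num, ← h]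
  gcongr

/-! ### Security with a strict bias bound -/

lemma IsDeltaBiased.mono {K : Type} [Fintype K] {N : ℕ} {δ δ' : ℝ} {s : K → Fin N → ZMod 2}
    (hs : IsDeltaBiased δ s) (h : δ ≤ δ') : IsDeltaBiased δ' s :=
  ⟨hs.1, fun w hw => (hs.2 w hw).trans h⟩

/-- A bias strictly below `ε 2^{-(n-t)/2}` gives both security notions. -/
lemma isSecure_of_isDeltaBiased_of_lt {K : Type} [Fintype K] {n : ℕ}
    {s : K → Fin (n + n) → ZMod 2} {δ t ε : ℝ} (hδ : 0 ≤ δ) (hs : IsDeltaBiased δ s)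
    (hlt : δ < ε / (2 : ℝ) ^ (((n : ℝ) - t) / 2)) :
    IsDeltaBiased (ε / (2 : ℝ) ^ (((n : ℝ) - t) / 2)) s ∧
      IsIndistinguishable (ambainisSmith s) t ε ∧ IsEntropicallySecure (ambainisSmith s) t ε := by
  have h : δ * Real.sqrt ((2 : ℝ) ^ n * (2 : ℝ) ^ (-t)) < ε := by
    refine lt_of_lt_of_eq ?_ (bias_bound_mul_sqrt n t ε)
    gcongr
  exact ⟨hs.mono hlt.le, isIndistinguishable_of_isDeltaBiased hδ hs h,
    isEntropicallySecure_of_isDeltaBiased hδ hs h.le⟩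

/-- There are finitely many characters, so the largest bias is attained and still strictly below
`δ`. The zero string is given the value 0, which also covers the case without nonzero strings. -/
lemma exists_isDeltaBiased_of_forall_lt {K : Type} [Fintype K] [Nonempty K] {N : ℕ}
    {s : K → Fin N → ZMod 2} {δ : ℝ} (hδ : 0 < δ) (h : ∀ w, w ≠ 0 → |bias s w| < δ) :
    ∃ δ', 0 ≤ δ' ∧ δ' < δ ∧ IsDeltaBiased δ' s := by
  obtain ⟨w₀, -, hmax⟩ := Finset.exists_max_image Finset.univ
    (fun w : Fin N → ZMod 2 => if w = 0 then 0 else |bias s w|) Finset.univ_nonempty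
  refine ⟨if w₀ = 0 then 0 else |bias s w₀|, by positivity, ?_,
    isDeltaBiased_iff.2 ⟨inferInstance, fun w hw => ?_⟩⟩
  · split_ifs with h0
    · exact hδ
    · exact h w₀ h0
  · simpa [hw] using hmax w (Finset.mem_univ w)

lemma bias_subtype {N : ℕ} (S : Finset (Fin N → ZMod 2)) (w : Fin N → ZMod 2) :
    bias (Subtype.val : S → Fin N → ZMod 2) w =
      (S.card : ℝ)⁻¹ * ∑ v ∈ S, sgn ℝ (v ⬝ᵥ w) := by
  rw [bias, Fintype.card_coe, Finset.sum_coe_sort S fun v => sgn ℝ (v ⬝ᵥ w)]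

/-- Sets of `2^r` strings, `r ≤ κ`, with bias less than `ε 2^{-(n-t)/2}`. -/
lemma exists_finset_card_two_pow_bias_lt {n : ℕ} {t ε : ℝ} (hn : 1 ≤ n) (hε : 0 < ε)
    (hκ : 0 ≤ keyLength n t ε) :
    ∃ (r : ℕ) (S : Finset (Fin (n + n) → ZMod 2)), S.card = 2 ^ r ∧ (r : ℝ) ≤ keyLength n t ε ∧
      ∀ w, w ≠ 0 → |bias (Subtype.val : S → Fin (n + n) → ZMod 2) w| <
        ε / (2 : ℝ) ^ (((n : ℝ) - t) / 2) := by
  have h := two_rpow_keyLength hn t hε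
  have hδ : 0 < ε / (2 : ℝ) ^ (((n : ℝ) - t) / 2) := by positivity
  set δ := ε / (2 : ℝ) ^ (((n : ℝ) - t) / 2)
  set κ := keyLength n t ε
  -- With `κ ≥ 2n` the set of all strings is affordable, and its bias is zero.
  by_cases hκn : ((n + n : ℕ) : ℝ) ≤ κ
  · refine ⟨n + n, Finset.univ, by simp, hκn, fun w hw => ?_⟩
    rw [bias_subtype, sum_sgn_dotProduct w hw, mul_zero, abs_zero]
    exact hδ
  rw [not_le] at hκn
  rcases hn.eq_or_lt with rfl | hn2
  -- For `n = 1` and `κ < 2` the identity `δ² 2^κ = 4` forces `δ > 1`, and a single string, of bias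
  -- 1, is enough.
  · refine ⟨0, {0}, by simp, by simpa using hκ, fun w _ => ?_⟩
    rw [bias_subtype]
    simp only [Finset.card_singleton, Finset.sum_singleton, Nat.cast_one, inv_one, one_mul, abs_sgn]
    have h1 : (2 : ℝ) ^ κ < 4 := by
      refine (Real.rpow_lt_rpow_of_exponent_lt one_lt_two hκn).trans_eq ?_
      norm_num
    by_contra! hδ1
    have h2 : δ ^ 2 ≤ 1 := pow_le_one₀ hδ.le hδ1
    have h3 : (0 : ℝ) < 2 ^ κ := by positivity
    norm_num at h
    nlinarith
  · have hr : ((⌊κ⌋₊ : ℕ) : ℝ) ≤ κ := Nat.floor_le hκ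
    have hr' : κ < ⌊κ⌋₊ + 1 := Nat.lt_floor_add_one κ
    set r := ⌊κ⌋₊
    have hrn : r ≤ n + n := by exact_mod_cast (hr.trans hκn.le)
    have hM : 2 * (n : ℝ) ^ 2 ≤ δ ^ 2 * (2 ^ r : ℕ) := by
      -- Rounding `κ` down loses at most a factor 2, leaving `δ² 2^r ≥ 2n²`.
      have h1 : (2 : ℝ) ^ κ ≤ 2 ^ r * 2 := by
        rw [← pow_succ, ← Real.rpow_natCast]
        exact Real.rpow_le_rpow_of_exponent_le one_le_two (by push_cast; exact hr'.le)
      have h2 : δ ^ 2 * (2 : ℝ) ^ κ ≤ δ ^ 2 * (2 ^ r * 2) := by gcongr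
      push_cast
      linarith
    obtain ⟨T, hT, hbias⟩ := exists_finset_bias_lt hn2
      (Nat.pow_le_pow_right two_pos hrn) hδ hM
    refine ⟨r, T, hT, hr, fun w hw => ?_⟩
    have hpos : (0 : ℝ) < (2 ^ r : ℕ) := by positivity
    rw [bias_subtype, hT, abs_mul, abs_of_pos (inv_pos.2 hpos), inv_mul_lt_iff₀ hpos, mul_comm]
    exact hbias w hw

end EntropicCipher

end

open EntropicCipher in
theorem mainTheorem3 :
    -- every `δ`-biased family gives an encryption scheme that satisfies the trace-norm bound
    (∀ (n : ℕ) (K : Type) [Fintype K] (s : K → Fin (n + n) → ZMod 2) (δ : ℝ),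
      0 ≤ δ → IsDeltaBiased δ s →
        IsEncryptionScheme (ambainisSmith s) ∧
        ∀ (E : Type) [Fintype E] [DecidableEq E]
          (ρ : Matrix ((Fin n → Fin 2) × E) ((Fin n → Fin 2) × E) ℂ) (t : ℝ),
          IsState ρ → t ≤ condMinEntropy ρ →
            traceNorm (view (ambainisSmith s) ρ
                - ((2 : ℂ) ^ n)⁻¹ • ((1 : Matrix (Fin n → Fin 2) (Fin n → Fin 2) ℂ) ⊗ₖ trA ρ))
              ≤ δ * Real.sqrt ((2 : ℝ) ^ n * (2 : ℝ) ^ (-t))) ∧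
    -- the explicit construction: a key of `2m` bits suffices as soon as `2m` is at least
    -- `n - t + 2 log n + 2 log (1/ε) + 2`
    (∀ (n : ℕ) (t ε : ℝ), 1 ≤ n → 0 < ε →
      ∀ (m : ℕ) (β : Module.Basis (Fin m) (ZMod 2) (GaloisField 2 m)),
        IsDeltaBiased ((2 * n : ℝ) / 2 ^ m) (aghp β (n + n)) ∧
        (keyLength n t ε ≤ 2 * m →
          IsDeltaBiased (ε / (2 : ℝ) ^ (((n : ℝ) - t) / 2)) (aghp β (n + n)) ∧
          IsIndistinguishable (ambainisSmith (aghp β (n + n))) t ε ∧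
          IsEntropicallySecure (ambainisSmith (aghp β (n + n))) t ε)) ∧
    -- with no restriction on the parameters: a set `S` of `2 ^ r` strings, that is, a key of
    -- `r` bits, where `r` is at most `n - t + 2 log n + 2 log (1/ε) + 2`
    (∀ (n : ℕ) (t ε : ℝ), 1 ≤ n → 0 < ε → 0 ≤ keyLength n t ε →
      ∃ (r : ℕ) (S : Finset (Fin (n + n) → ZMod 2)),
        S.card = 2 ^ r ∧ (r : ℝ) ≤ keyLength n t ε ∧
        IsDeltaBiased (ε / (2 : ℝ) ^ (((n : ℝ) - t) / 2))
          (Subtype.val : S → Fin (n + n) → ZMod 2) ∧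
        IsIndistinguishable (ambainisSmith (Subtype.val : S → Fin (n + n) → ZMod 2)) t ε ∧
        IsEntropicallySecure (ambainisSmith (Subtype.val : S → Fin (n + n) → ZMod 2)) t ε) := by
  refine ⟨fun n K _ s δ hδ hs => ⟨isEncryptionScheme_ambainisSmith s, fun E _ _ ρ t hρ ht => ?_⟩,
    fun n t ε hn hε m β => ?_, fun n t ε hn hε hκ => ?_⟩
  · rw [view_sub_eq_ampliation_deviation]
    exact traceNorm_ampliation_deviation_le hδ hs hρ ht
  · have hn' : (1 : ℝ) ≤ n := by exact_mod_cast hn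
    have hβ := isDeltaBiased_aghp (N := n + n) (by omega) β
    -- The degree is at most `2n - 1`, not `2n`; this gap gives the strict inequality that
    -- indistinguishability requires.
    have hlt : (((n + n : ℕ) : ℝ) - 1) / 2 ^ m < (2 * n : ℝ) / 2 ^ m := by
      push_cast
      gcongr
      linarith
    refine ⟨hβ.mono hlt.le, fun hm => ?_⟩
    refine isSecure_of_isDeltaBiased_of_lt ?_ hβ (hlt.trans_le (two_mul_div_two_pow_le hn hε hm))
    push_cast
    exact div_nonneg (by linarith) (by positivity)
  · obtain ⟨r, S, hS, hr, hlt⟩ := exists_finset_card_two_pow_bias_lt hn hε hκ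
    have : Nonempty S := by
      rw [Finset.nonempty_coe_sort, ← Finset.card_pos, hS]
      positivity
    obtain ⟨δ', hδ', hlt', hbias⟩ := exists_isDeltaBiased_of_forall_lt (by positivity) hlt
    exact ⟨r, S, hS, hr, isSecure_of_isDeltaBiased_of_lt hδ' hbias hlt'⟩
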